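/- Let $K$ be a field of characteristic $0$ (for instance $\mathbb{Q}$ or $\mathbb{Q}(q)$) and let $\Lambda=K[p_1,p_2,\dots]$ be the algebra of symmetric functions over $K$, with the Hall scalar product $\langle p_\lambda,p_\mu\rangle=\delta_{\lambda\mu}z_\lambda$. For $f\in\Lambda$ let $f^\perp$ be the adjoint of multiplication by $f$. For $m\in\mathbb{Z}$ put $$S_m=\sum_{k\ge0}(-1)^k h_{m+k}e_k^\perp,\qquad \tilde S_m=\sum_{k\ge0}(-1)^k e_{m+k}h_k^\perp,$$ where $h_n$ and $e_n$ are the complete and elementary symmetric functions ($0$ for $n<0$). For a linear operator $V$ on $\Lambda$ its hat $\overline V$ is the operator $$\overline V P[X]=\bigl(V^Y P[X-Y]\bigr)\big|_{Y=X},$$ where $P[X-Y]$ is obtained from $P$ by replacing each $p_n$ by $p_n[X]-p_n[Y]$, and $V^Y$ acts in the variables $Y$ only. A ribbon of size $k$, written $R\models k$, is a skew diagram $R=\lambda/\lambda^{rc}$ with $k$ cells, where $\lambda=(\lambda_1,\dots,\lambda_\ell)$ is a nonempty partition (drawn in the French convention, the longest row at the bottom) and $\lambda^{rc}=(\lambda_2-1,\dots,\lambda_\ell-1)$.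 Number its cells $1,\dots,k$ from left to right, top to bottom; $D(R)\subseteq\{1,\dots,k-1\}$ is the set of those $i$ for which the $(i+1)$-st cell lies below the $i$-th one, and $\mathrm{comaj}(R)=\binom k2-\sum_{i\in D(R)}i$. The ribbon operator of $R$ is $$S^R=s_{\lambda^{rc}}^\perp\,\tilde S_{\lambda'_1}\tilde S_{\lambda'_2}\cdots\tilde S_{\lambda'_{\lambda_1}},$$ where $\lambda'_i$ is the length of the $i$-th column of $\lambda$. For $q\in K$ and $k\ge1$ let $H_{1^k}^q=\sum_{R\models k}q^{\mathrm{comaj}(R)}S^R$. Theorem. (1) If $R\models k$ and $R_+\models k+1$ with $D(R_+)=D(R)\cup\{k\}$, then $R_+$ is $R$ with one cell added directly below its last cell, and $$\overline{\,\overline{S^R}\,S_1\,}=S^{R_+}.$$ (2) If $R\models k$ and $R^+\models k+1$ with $D(R^+)=D(R)$, then $R^+$ is $R$ with one cell added directly to the right of its last cell, and $S^R\tilde S_1=S^{R^+}$. (3) For every $q\in K$ one has $H_{1^1}^q=\tilde S_1$, and for all $k\ge2$ $$H_{1^k}^q=q^{k-1}H_{1^{k-1}}^q\tilde S_1+\overline{\,\overline{H_{1^{k-1}}^q}\,S_1\,}.$$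 -/

import Mathlib

noncomputable section

namespace RibbonOps

open MvPolynomial

/-! ### Symmetric functions as polynomials in the power sums -/

/-- The algebra of symmetric functions over `K`, as the polynomial algebra in the power sums
`p₁, p₂, p₃, …`; the variable with index `n : ℕ+` is `pₙ`. -/
abbrev Lam (K : Type*) [Field K] := MvPolynomial ℕ+ K

/-- The linear operators on symmetric functions; the product is composition. -/
abbrev Op (K : Type*) [Field K] := Module.End K (Lam K)

section SymmetricFunctions

variable (K : Type*) [Field K]

/-- The power sum `p_{i+1}`. -/
def psumSucc (i : ℕ) : Lam K := X i.succPNat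

/-- The complete symmetric function `hₙ`, through `n hₙ = ∑_{i=1}^n pᵢ h_{n-i}`. -/
def hNat : ℕ → Lam K
  | 0 => 1
  | n + 1 => ((n + 1 : ℕ) : K)⁻¹ • ∑ i : Fin (n + 1), psumSucc K i * hNat (n - i)
termination_by n => n
decreasing_by omega

/-- The elementary symmetric function `eₙ`, through
`n eₙ = ∑_{i=1}^n (-1)^{i-1} pᵢ e_{n-i}`. -/
def eNat : ℕ → Lam K
  | 0 => 1
  | n + 1 => ((n + 1 : ℕ) : K)⁻¹ •
      ∑ i : Fin (n + 1), (-1 : K) ^ (i : ℕ) • (psumSucc K i * eNat (n - i))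
termination_by n => n
decreasing_by omega

/-- `hₙ` for an integer index, zero if `n < 0`. -/
def hInt (n : ℤ) : Lam K := if 0 ≤ n then hNat K n.toNat else 0

/-- `eₙ` for an integer index, zero if `n < 0`. -/
def eInt (n : ℤ) : Lam K := if 0 ≤ n then eNat K n.toNat else 0

/-- The Schur function of a partition, by the Jacobi-Trudi determinant
`det (h_{μᵢ - i + j})` of size the number of (nonzero) parts. -/
def schur (μ : YoungDiagram) : Lam K :=
  Matrix.det (Matrix.of fun i j : Fin (μ.colLen 0) =>
    hInt K ((μ.rowLen i : ℤ) - (i : ℤ) + (j : ℤ)))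

/-- `z_λ = ∏ i^{nᵢ} nᵢ!`, where `λ` has `nᵢ` parts of size `i`. -/
def zee (a : ℕ+ →₀ ℕ) : ℕ := a.prod fun i n => (i : ℕ) ^ n * n.factorial

/-- The Hall scalar product: `⟨p_λ, p_μ⟩ = δ_{λμ} z_λ`. -/
def hall : Lam K →ₗ[K] Lam K →ₗ[K] K :=
  (basisMonomials ℕ+ K).constr K fun a =>
    (basisMonomials ℕ+ K).constr K fun b => if a = b then (zee a : K) else 0

/-- Skewing: `skew K f` is the operator `f^⊥`, given on power sums by
`p_μ^⊥ p_λ = (z_λ / z_{λ∖μ}) p_{λ∖μ}` if `μ` is a submultiset of `λ`, and `0` otherwise.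
It is adjoint to multiplication by `f`, see `hall_skew`. -/
def skew : Lam K →ₗ[K] Op K :=
  (basisMonomials ℕ+ K).constr K fun b =>
    (basisMonomials ℕ+ K).constr K fun a =>
      if b ≤ a then monomial (a - b) ((zee a : K) / (zee (a - b) : K)) else 0

variable {K}

lemma hall_monomial (a b : ℕ+ →₀ ℕ) :
    hall K (monomial a 1) (monomial b 1) = if a = b then (zee a : K) else 0 := by
  have h1 := (basisMonomials ℕ+ K).constr_basis K
    (fun a => (basisMonomials ℕ+ K).constr K fun b => if a = b then (zee a : K) else 0) a
  have h2 := (basisMonomials ℕ+ K).constr_basis K (fun b => if a = b then (zee a : K) else 0) b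
  simp only [coe_basisMonomials] at h1 h2
  rw [hall, h1, h2]

lemma skew_monomial (a b : ℕ+ →₀ ℕ) :
    skew K (monomial b 1) (monomial a 1) =
      if b ≤ a then monomial (a - b) ((zee a : K) / (zee (a - b) : K)) else 0 := by
  have h1 := (basisMonomials ℕ+ K).constr_basis K
    (fun b => (basisMonomials ℕ+ K).constr K fun a =>
      if b ≤ a then monomial (a - b) ((zee a : K) / (zee (a - b) : K)) else (0 : Lam K)) b
  have h2 := (basisMonomials ℕ+ K).constr_basis K
    (fun a => if b ≤ a then monomial (a - b) ((zee a : K) / (zee (a - b) : K))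
      else (0 : Lam K)) a
  simp only [coe_basisMonomials] at h1 h2
  rw [skew, h1, h2]

lemma zee_ne_zero [CharZero K] (a : ℕ+ →₀ ℕ) : (zee a : K) ≠ 0 := by
  rw [Nat.cast_ne_zero]
  refine Finset.prod_ne_zero_iff.2 fun i _ => ?_
  exact mul_ne_zero (pow_ne_zero _ i.pos.ne') (Nat.factorial_ne_zero _)

lemma lam_induction {P : Lam K → Prop} (f : Lam K) (hm : ∀ a, P (monomial a 1))
    (hs : ∀ (c : K) g, P g → P (c • g)) (ha : ∀ g h, P g → P h → P (g + h)) : P f := by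
  induction f using MvPolynomial.induction_on' with
  | monomial u c =>
    have : (monomial u c : Lam K) = c • monomial u 1 := by rw [smul_monomial]; simp
    rw [this]
    exact hs _ _ (hm _)
  | add p q hp hq => exact ha _ _ hp hq

/-- `f^⊥` is adjoint to multiplication by `f`. -/
theorem hall_skew [CharZero K] (f g h : Lam K) :
    hall K (skew K f g) h = hall K g (f * h) := by
  induction f using lam_induction with
  | hs c p hp => simp [hp]
  | ha p q hp hq => simp [hp, hq, add_mul]
  | hm b =>
  induction g using lam_induction with
  | hs c p hp => simp [hp]
  | ha p q hp hq => simp [hp, hq]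
  | hm a =>
  induction h using lam_induction with
  | hs c p hp => simp [hp]
  | ha p q hp hq => simp [hp, hq, mul_add]
  | hm d =>
    rw [skew_monomial, monomial_mul, one_mul, hall_monomial]
    by_cases hba : b ≤ a
    · have hmon : (monomial (a - b) ((zee a : K) / (zee (a - b) : K)) : Lam K) =
          ((zee a : K) / (zee (a - b) : K)) • monomial (a - b) 1 := by
        rw [smul_monomial]; simp
      rw [if_pos hba, hmon, map_smul, LinearMap.smul_apply, hall_monomial]
      by_cases hd : a - b = d
      · have : a = b + d := by rw [← hd, add_tsub_cancel_of_le hba]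
        rw [if_pos hd, if_pos this, smul_eq_mul, div_mul_cancel₀ _ (zee_ne_zero _)]
      · have : a ≠ b + d := fun h => hd (by rw [h, add_tsub_cancel_left])
        rw [if_neg hd, if_neg this, smul_zero]
    · have : a ≠ b + d := fun h => hba (h ▸ le_self_add)
      rw [if_neg hba, if_neg this, map_zero, LinearMap.zero_apply]

/-- Weighted degree with `deg pₙ = n`. -/
def wt : ℕ+ → ℕ := fun n => n

lemma psumSucc_homogeneous (i : ℕ) : IsWeightedHomogeneous wt (psumSucc K i) (i + 1) :=
  isWeightedHomogeneous_X K wt i.succPNat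

lemma hNat_homogeneous (n : ℕ) : IsWeightedHomogeneous wt (hNat K n) n := by
  induction n using Nat.strong_induction_on with
  | _ n ih =>
  cases n with
  | zero => rw [hNat]; exact isWeightedHomogeneous_one K wt
  | succ n =>
    rw [hNat]
    refine (weightedHomogeneousSubmodule K wt (n + 1)).smul_mem _ ?_
    refine IsWeightedHomogeneous.sum _ _ _ fun i _ => ?_
    have := (psumSucc_homogeneous (K := K) i).mul (ih (n - i) (by omega))
    rwa [show (i : ℕ) + 1 + (n - i) = n + 1 by omega] at this

lemma eNat_homogeneous (n : ℕ) : IsWeightedHomogeneous wt (eNat K n) n := by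
  induction n using Nat.strong_induction_on with
  | _ n ih =>
  cases n with
  | zero => rw [eNat]; exact isWeightedHomogeneous_one K wt
  | succ n =>
    rw [eNat]
    refine (weightedHomogeneousSubmodule K wt (n + 1)).smul_mem _ ?_
    refine IsWeightedHomogeneous.sum _ _ _ fun i _ => ?_
    refine (weightedHomogeneousSubmodule K wt (n + 1)).smul_mem _ ?_
    have := (psumSucc_homogeneous (K := K) i).mul (ih (n - i) (by omega))
    rwa [show (i : ℕ) + 1 + (n - i) = n + 1 by omega] at this

lemma skew_eq_zero_of_lt (f : Lam K) (n : ℕ) (hf : IsWeightedHomogeneous wt f n)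
    (a : ℕ+ →₀ ℕ) (ha : Finsupp.weight wt a < n) : skew K f (monomial a 1) = 0 := by
  rw [f.as_sum, map_sum, LinearMap.sum_apply]
  refine Finset.sum_eq_zero fun b hb => ?_
  have hmon : (monomial b (coeff b f) : Lam K) = coeff b f • monomial b 1 := by
    rw [smul_monomial]; simp
  have hw : Finsupp.weight wt b = n := hf (mem_support_iff.1 hb)
  rw [hmon, map_smul, LinearMap.smul_apply, skew_monomial, if_neg, smul_zero]
  intro hle
  have : Finsupp.weight wt a = Finsupp.weight wt b + Finsupp.weight wt (a - b) := by
    rw [← map_add, add_tsub_cancel_of_le hle]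
  omega

/-- Only finitely many homogeneous `g_k^⊥` act nontrivially on a given `P`. -/
lemma finite_skew (g : ℕ → Lam K) (hg : ∀ k, IsWeightedHomogeneous wt (g k) k) (P : Lam K) :
    {k : ℕ | skew K (g k) P ≠ 0}.Finite := by
  induction P using lam_induction with
  | hm a =>
    refine (Set.finite_Iic (Finsupp.weight wt a)).subset fun k hk => ?_
    by_contra h
    exact hk (skew_eq_zero_of_lt _ k (hg k) a (not_le.1 h))
  | hs c p hp => exact hp.subset fun k hk h => hk (by simp [h])
  | ha p q hp hq =>
    refine (hp.union hq).subset fun k hk => ?_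
    by_contra h
    simp only [Set.mem_union, Set.mem_ofPred_eq, not_or, not_not] at h
    exact hk (by simp [h.1, h.2])

lemma finite_vertex (c : ℕ → Lam K) (g : ℕ → Lam K)
    (hg : ∀ k, IsWeightedHomogeneous wt (g k) k) (P : Lam K) :
    (Function.support fun k : ℕ => (-1 : K) ^ k • (c k * skew K (g k) P)).Finite :=
  (finite_skew g hg P).subset fun k hk h => hk (by simp [h])

/-- The operator `P ↦ ∑_{k ≥ 0} (-1)^k c_k g_k^⊥ P` for `g_k` homogeneous of degree `k`; for each
`P` the sum is finite. -/
def vertex (c : ℕ → Lam K) (g : ℕ → Lam K) (hg : ∀ k, IsWeightedHomogeneous wt (g k) k) :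
    Op K where
  toFun P := ∑ᶠ k : ℕ, (-1 : K) ^ k • (c k * skew K (g k) P)
  map_add' P Q := by
    rw [← finsum_add_distrib (finite_vertex c g hg P) (finite_vertex c g hg Q)]
    exact finsum_congr fun k => by rw [map_add, mul_add, smul_add]
  map_smul' r P := by
    rw [RingHom.id_apply, smul_finsum' r (finite_vertex c g hg P)]
    exact finsum_congr fun k => by rw [map_smul, mul_smul_comm, smul_comm]

variable (K)

/-- Bernstein's operator `S_m = ∑_{k ≥ 0} (-1)^k h_{m+k} e_k^⊥`, which adds a row. -/
def bernstein (m : ℤ) : Op K := vertex (fun k => hInt K (m + k)) (eNat K) eNat_homogeneous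

/-- The operator `S̃_m = ∑_{k ≥ 0} (-1)^k e_{m+k} h_k^⊥` (that is, `ω S_m ω`), which adds a
column. -/
def bernsteinCol (m : ℤ) : Op K := vertex (fun k => eInt K (m + k)) (hNat K) hNat_homogeneous

variable {K}

open scoped TensorProduct in
/-- The substitution `P[X] ↦ P[X - Y]`, with the symmetric functions in `X` and in `Y` as the left
and the right tensor factor: `pₙ ↦ pₙ[X] - pₙ[Y]`. -/
def subDiff : Lam K →ₐ[K] Lam K ⊗[K] Lam K :=
  aeval fun n => (X n : Lam K) ⊗ₜ[K] (1 : Lam K) - (1 : Lam K) ⊗ₜ[K] (X n : Lam K)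

/-- The hat of an operator: `V̄ P[X] = (V^Y P[X - Y])|_{Y = X}`, where `V` acts on the symmetric
functions in `Y` only. -/
def hat (V : Op K) : Op K :=
  LinearMap.mul' K (Lam K) ∘ₗ V.lTensor (Lam K) ∘ₗ (subDiff (K := K)).toLinearMap

end SymmetricFunctions

/-! ### Ribbons

In the cell `(i, j)` of a Young diagram, `i` is the row and `j` the column, both counted from `0`.
Row `0` is the longest one and is drawn at the bottom (French convention), so that a cell with a
smaller `i` lies lower. -/

/-- `λ^rc = (λ₂ - 1, λ₃ - 1, …)`: the first row and the first column are removed. -/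
def rc (μ : YoungDiagram) : YoungDiagram where
  cells := μ.cells.filter (fun c => (c.1 + 1, c.2 + 1) ∈ μ)
  isLowerSet := by
    rintro ⟨i, j⟩ ⟨i', j'⟩ h hc
    obtain ⟨hi, hj⟩ : i' ≤ i ∧ j' ≤ j := h
    simp only [Finset.coe_filter, Set.mem_ofPred_eq, YoungDiagram.mem_cells] at hc ⊢
    exact ⟨μ.up_left_mem hi hj hc.1, μ.up_left_mem (by omega) (by omega) hc.2⟩

lemma mem_rc {μ : YoungDiagram} {i j : ℕ} : (i, j) ∈ rc μ ↔ (i + 1, j + 1) ∈ μ := by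
  change (i, j) ∈ μ.cells.filter (fun c => (c.1 + 1, c.2 + 1) ∈ μ) ↔ _
  simp only [Finset.mem_filter, YoungDiagram.mem_cells, and_iff_right_iff_imp]
  exact fun h => μ.up_left_mem (by omega) (by omega) h

/-- `λ^rc` has the parts `λ_{i+1} - 1`. -/
lemma rowLen_rc (μ : YoungDiagram) (i : ℕ) : (rc μ).rowLen i = μ.rowLen (i + 1) - 1 := by
  refine eq_of_forall_lt_iff fun j => ?_
  rw [← YoungDiagram.mem_iff_lt_rowLen, mem_rc, YoungDiagram.mem_iff_lt_rowLen]
  omega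

/-- The cells of the skew diagram `λ/λ^rc`. -/
def ribbonCells (μ : YoungDiagram) : Finset (ℕ × ℕ) := μ.cells \ (rc μ).cells

/-- `Ribbon k` is the type of ribbons `R ⊨ k`: skew diagrams `R = λ/λ^rc` with `k` cells, for a
nonempty partition `λ`. Such an `R` determines `λ`, and is stored as `λ`. -/
@[ext]
structure Ribbon (k : ℕ) where
  /-- the partition `λ` -/
  outer : YoungDiagram
  outer_ne_bot : outer ≠ ⊥
  card_cells : (ribbonCells outer).card = k

namespace Ribbon

variable {k : ℕ}

/-- The cells of a ribbon. -/
def cells (R : Ribbon k) : Finset (ℕ × ℕ) := ribbonCells R.outer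

/-- The label of a cell of a ribbon when the cells are numbered `1, 2, …, k` from left to right, top
to bottom: the number of cells of the ribbon weakly to the left of and weakly above it. -/
def label (R : Ribbon k) (c : ℕ × ℕ) : ℕ :=
  (R.cells.filter fun d => d.2 ≤ c.2 ∧ c.1 ≤ d.1).card

/-- The descent set `D(R)`: the `i ∈ [1, k - 1]` such that the `(i+1)`-st cell lies below the
`i`-th cell. -/
def descents (R : Ribbon k) : Finset ℕ :=
  (Finset.Icc 1 (k - 1)).filter fun i =>
    ∃ c ∈ R.cells, ∃ d ∈ R.cells, R.label c = i ∧ R.label d = i + 1 ∧ d.1 < c.1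

/-- The major index. -/
def maj (R : Ribbon k) : ℕ := ∑ i ∈ R.descents, i

/-- The complementary major index `binom(k, 2) - maj(R)`. -/
def comaj (R : Ribbon k) : ℕ := k.choose 2 - R.maj

lemma maj_add_comaj (R : Ribbon k) : R.maj + R.comaj = k.choose 2 := by
  refine Nat.add_sub_of_le ?_
  calc R.maj ≤ ∑ i ∈ Finset.Icc 1 (k - 1), i :=
        Finset.sum_le_sum_of_subset (Finset.filter_subset _ _)
    _ ≤ ∑ i ∈ Finset.range k, i :=
        Finset.sum_le_sum_of_ne_zero fun i hi _ => by
          simp only [Finset.mem_Icc, Finset.mem_range] at *; omega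
    _ = k.choose 2 := by rw [Finset.sum_range_id, Nat.choose_two_right]

/-- The ribbon operator `S^R = s_{λ^rc}^⊥ S̃_{λ'₁} S̃_{λ'₂} ⋯ S̃_{λ'_{λ₁}}` for `R = λ/λ^rc`, where
`λ'ᵢ` is the length of the `i`-th column of `λ`. -/
def op (K : Type*) [Field K] (R : Ribbon k) : Op K :=
  skew K (schur K (rc R.outer)) *
    ((List.range (R.outer.rowLen 0)).map fun j => bernsteinCol K (R.outer.colLen j)).prod

lemma outer_cells_subset (R : Ribbon k) : R.outer.cells ⊆ Finset.range k ×ˢ Finset.range k := by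
  rintro ⟨i, j⟩ h
  rw [YoungDiagram.mem_cells] at h
  have h1 : R.outer.colLen 0 ≤ k := by
    conv_rhs => rw [← R.card_cells]
    rw [← Finset.card_range (R.outer.colLen 0)]
    refine Finset.card_le_card_of_injOn (fun i => (i, R.outer.rowLen i - 1)) ?_ ?_
    · intro a ha
      have ha' : (a, 0) ∈ R.outer := YoungDiagram.mem_iff_lt_colLen.2 (by simpa using ha)
      rw [YoungDiagram.mem_iff_lt_rowLen] at ha'
      simp only [ribbonCells, Finset.coe_sdiff, Set.mem_sdiff, Finset.mem_coe,
        YoungDiagram.mem_cells, mem_rc]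
      refine ⟨YoungDiagram.mem_iff_lt_rowLen.2 (by omega), fun h => ?_⟩
      have := YoungDiagram.mem_iff_lt_rowLen.1 h
      have := R.outer.rowLen_anti a (a + 1) (by omega)
      omega
    · intro a _ b _ hab
      exact (Prod.ext_iff.1 hab).1
  have h2 : R.outer.rowLen 0 ≤ k := by
    conv_rhs => rw [← R.card_cells]
    rw [← Finset.card_range (R.outer.rowLen 0)]
    refine Finset.card_le_card_of_injOn (fun j => (R.outer.colLen j - 1, j)) ?_ ?_
    · intro a ha
      have ha' : (0, a) ∈ R.outer := YoungDiagram.mem_iff_lt_rowLen.2 (by simpa using ha)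
      rw [YoungDiagram.mem_iff_lt_colLen] at ha'
      simp only [ribbonCells, Finset.coe_sdiff, Set.mem_sdiff, Finset.mem_coe,
        YoungDiagram.mem_cells, mem_rc]
      refine ⟨YoungDiagram.mem_iff_lt_colLen.2 (by omega), fun h => ?_⟩
      have := YoungDiagram.mem_iff_lt_colLen.1 h
      have := R.outer.colLen_anti a (a + 1) (by omega)
      omega
    · intro a _ b _ hab
      exact (Prod.ext_iff.1 hab).2
  have h3 := YoungDiagram.mem_iff_lt_colLen.1 (R.outer.up_left_mem le_rfl (Nat.zero_le j) h)
  have h4 := YoungDiagram.mem_iff_lt_rowLen.1 (R.outer.up_left_mem (Nat.zero_le i) le_rfl h)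
  simp only [Finset.mem_product, Finset.mem_range]
  omega

instance (k : ℕ) : Finite (Ribbon k) := by
  refine Finite.of_injective
    (fun R : Ribbon k => (⟨R.outer.cells, Finset.mem_powerset.2 R.outer_cells_subset⟩ :
      {s // s ∈ (Finset.range k ×ˢ Finset.range k).powerset})) fun R R' h => ?_
  exact Ribbon.ext (YoungDiagram.ext (congrArg Subtype.val h))

instance (k : ℕ) : Fintype (Ribbon k) := Fintype.ofFinite _

end Ribbon

/-- The operator `H_{1^k}^q = ∑_{R ⊨ k} q^{comaj(R)} S^R` for `k ≥ 1`; by convention,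
`H_{1^0}^q = S̃_0`. -/
def hallLittlewoodCol {K : Type*} [Field K] (q : K) : ℕ → Op K
  | 0 => bernsteinCol K 0
  | k + 1 => ∑ R : Ribbon (k + 1), q ^ R.comaj • R.op K

end RibbonOps

end

noncomputable section

namespace RibbonOps

open MvPolynomial
open scoped TensorProduct

variable {K : Type*} [Field K]

/-! ### The Hall scalar product and skewing -/

/-! A ribbon is determined by its descent set (`Ribbon.descents_injective`), so the ribbons of (1)
and (2) are the ones obtained from `R` by adding a last cell below or to the right. On the outer
partition `λ`, adding to the right appends a column of height one and leaves `λ^rc` unchanged, which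
gives (2) from the definition. Adding below doubles the first row: every column grows by one, and
`λ^rc` gains a first row of length `λ₁ - 1`, possibly empty. By the Jacobi-Trudi form of Bernstein's
construction (`bernstein_jacobiTrudi`), the new Schur function is `S_{λ₁-1}` applied to the old one.

Thus (1) asks that `V ↦ hat (hat V * S_1)` turn `f^⊥ S̃_{a₁} ⋯ S̃_{aₙ}` into `(S_{n-1} f)^⊥
S̃_{a₁+1} ⋯ S̃_{aₙ+1}`. The columns are peeled off one at a time with `hat_hat_mul_bernstein`, each
raising the index of its `S̃` and lowering that of `S` by one. To prove this exchange, expand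
`e_{a+k}[X - Y]`: this shows that `hat W * S̃_a` is the hat of `∑ (-1)^{a-i} e_i W S_{a-i}`
(`hat_twist`). The commutation rule `S_m S_n = -S_{n-1} S_{m+1}` (`bernstein_bernstein`) then moves
a factor `S_n` on the right through that sum, and the hat is an involution. What remains is the case
of no columns, `hat_hat_skew_mul_bernstein`. There the hat of `f^⊥` is the functional `P ↦ ⟨P,
f[-X]⟩`, and the claim becomes an adjunction between `S_{-m}` and `S_m`.

For (3), every ribbon with at least two cells arises from exactly one smaller ribbon by exactly one
of the two additions. Since `binom(k+1, 2) = binom(k, 2) + k`, adding to the right raises `comaj` by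
`k`; adding below creates the descent `k` and leaves `comaj` fixed. -/

lemma hall_comm (f g : Lam K) : hall K f g = hall K g f := by
  induction f using lam_induction with
  | hs c p hp => simp [hp]
  | ha p q hp hq => simp [hp, hq]
  | hm a =>
  induction g using lam_induction with
  | hs c p hp => simp [hp]
  | ha p q hp hq => simp [hp, hq]
  | hm b =>
    rw [hall_monomial, hall_monomial]
    by_cases h : a = b
    · simp [h]
    · rw [if_neg h, if_neg (Ne.symm h)]

lemma hall_monomial_right (f : Lam K) (a : ℕ+ →₀ ℕ) :
    hall K f (monomial a 1) = (zee a : K) * coeff a f := by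
  induction f using lam_induction with
  | hs c p hp => simp [hp]; ring
  | ha p q hp hq => simp [hp, hq]; ring
  | hm b =>
    rw [hall_monomial, coeff_monomial]
    by_cases h : b = a <;> simp [h]

lemma hall_one_right (f : Lam K) : hall K f 1 = constantCoeff f := by
  have := hall_monomial_right f 0
  simpa [zee, constantCoeff_eq] using this

/-- The power sum products form an orthogonal basis with norms `z_λ`, which are nonzero in
characteristic zero. Operator identities can therefore be checked on adjoints. -/
lemma ext_hall [CharZero K] {f g : Lam K} (h : ∀ Q, hall K f Q = hall K g Q) : f = g := by
  ext a
  have := h (monomial a 1)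
  rw [hall_monomial_right, hall_monomial_right] at this
  exact mul_left_cancel₀ (zee_ne_zero a) this

lemma constantCoeff_skew [CharZero K] (f g : Lam K) :
    constantCoeff (skew K f g) = hall K g f := by
  rw [← hall_one_right, hall_skew, mul_one]

lemma skew_mul [CharZero K] (f g : Lam K) : skew K (f * g) = skew K f * skew K g := by
  refine LinearMap.ext fun P => ext_hall fun Q => ?_
  rw [Module.End.mul_apply, hall_skew, hall_skew, hall_skew, mul_left_comm, mul_assoc]

lemma skew_one [CharZero K] : skew K (1 : Lam K) = 1 := by
  refine LinearMap.ext fun P => ext_hall fun Q => ?_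
  rw [hall_skew, one_mul, Module.End.one_apply]

lemma skew_comm_apply [CharZero K] (f g P : Lam K) :
    skew K f (skew K g P) = skew K g (skew K f P) := by
  rw [← Module.End.mul_apply, ← skew_mul, mul_comm, skew_mul, Module.End.mul_apply]

/-- Removing one part `n` divides `z_a` by `n` times the multiplicity of `n` in `a`, which is the
factor produced by `n ∂/∂pₙ`. -/
lemma skew_X [CharZero K] (n : ℕ+) (P : Lam K) :
    skew K (X n) P = ((n : ℕ) : K) • pderiv n P := by
  induction P using lam_induction with
  | hs c p hp => rw [map_smul, hp, Derivation.map_smul, smul_comm]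
  | ha p q hp hq => rw [map_add, hp, hq, map_add, smul_add]
  | hm a =>
    rw [X, skew_monomial, pderiv_monomial, smul_monomial]
    by_cases h : a n = 0
    · rw [if_neg (by simp [Finsupp.single_le_iff, h])]
      simp [h]
    · have hle : Finsupp.single n 1 ≤ a := by
        rw [Finsupp.single_le_iff]; omega
      rw [if_pos hle]
      congr 1
      rw [div_eq_iff (zee_ne_zero _), one_mul, smul_eq_mul]
      have key : zee a = n * a n * zee (a - Finsupp.single n 1) := by
        obtain ⟨m, hm⟩ : ∃ m, a n = m + 1 := Nat.exists_eq_succ_of_ne_zero h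
        have h1 := Finsupp.mul_prod_erase' a n (fun i n => (i : ℕ) ^ n * n.factorial)
          (fun i => by simp)
        have h2 := Finsupp.mul_prod_erase' (a - Finsupp.single n 1) n
          (fun i n => (i : ℕ) ^ n * n.factorial) (fun i => by simp)
        have h3 : (a - Finsupp.single n 1).erase n = a.erase n := by
          ext i
          by_cases hi : i = n
          · simp [hi]
          · simp [Finsupp.erase_ne hi, Ne.symm hi]
        rw [zee, zee, ← h1, ← h2, h3]
        simp only [Finsupp.tsub_apply, Finsupp.single_eq_same, hm, Nat.add_sub_cancel,
          Nat.factorial_succ, pow_succ]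
        ring
      rw [key]
      push_cast
      ring

lemma skew_X_mul [CharZero K] (n : ℕ+) (f g : Lam K) :
    skew K (X n) (f * g) = skew K (X n) f * g + f * skew K (X n) g := by
  simp only [skew_X, Derivation.leibniz, smul_eq_mul, smul_add, mul_smul_comm, smul_mul_assoc]
  ring_nf

lemma skew_X_X [CharZero K] (m n : ℕ+) :
    skew K (X n) (X m : Lam K) = if m = n then ((n : ℕ) : Lam K) else 0 := by
  rw [skew_X, pderiv_X]
  by_cases h : m = n
  · subst h
    simp [Algebra.smul_def]
  · simp [h]

/-- This is the adjoint of the Leibniz rule for the derivation `pₙ^⊥`. -/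
lemma skew_mul_X [CharZero K] (n : ℕ+) (f P : Lam K) :
    skew K f (X n * P) = X n * skew K f P + skew K (skew K (X n) f) P := by
  refine ext_hall fun Q => ?_
  calc hall K (skew K f (X n * P)) Q = hall K (f * Q) (X n * P) := by rw [hall_skew, hall_comm]
    _ = hall K P (skew K (X n) f * Q) + hall K P (f * skew K (X n) Q) := by
      rw [← hall_skew, hall_comm, skew_X_mul, map_add]
    _ = hall K (skew K (skew K (X n) f) P) Q + hall K (X n * skew K f P) Q := by
      rw [hall_skew, ← hall_skew f, hall_comm (skew K f P), hall_skew, hall_comm Q]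
    _ = _ := by rw [map_add, LinearMap.add_apply, add_comm]

/-! ### Generating series of the complete and elementary symmetric functions -/

/-- A power series which satisfies a homogeneous linear differential equation of order one and has
constant term zero vanishes. -/
lemma eq_zero_of_derivative_eq_mul [CharZero K] {A : Type*} [CommRing A] [Algebra K A]
    (g F : PowerSeries A) (h0 : PowerSeries.coeff 0 F = 0)
    (h : PowerSeries.derivative A F = g * F) : F = 0 := by
  ext n
  induction n using Nat.strong_induction_on with
  | _ n ih =>
  cases n with
  | zero => simpa using h0
  | succ n =>
    have h1 := congrArg (PowerSeries.coeff n) h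
    rw [PowerSeries.coeff_derivative, PowerSeries.coeff_mul,
      Finset.sum_eq_zero fun x hx => ?_] at h1
    · have h2 : ((n + 1 : ℕ) : K) • PowerSeries.coeff (n + 1) F = 0 := by
        rw [Algebra.smul_def, map_natCast, mul_comm]
        exact_mod_cast h1
      rw [map_zero]
      rw [← inv_smul_smul₀ (Nat.cast_ne_zero.2 n.succ_ne_zero : ((n + 1 : ℕ) : K) ≠ 0)
        (PowerSeries.coeff (n + 1) F), h2, smul_zero]
    · rw [ih x.2 (by rw [Finset.HasAntidiagonal.mem_antidiagonal] at hx; omega), map_zero, mul_zero]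

/-- The recursion which defines the complete (for `ε = 1`) and elementary (for `ε = -1`) symmetric
functions. -/
structure IsGen (ε : K) (c : ℕ → Lam K) : Prop where
  zero : c 0 = 1
  succ : ∀ n, ((n + 1 : ℕ) : K) • c (n + 1) =
    ∑ i ∈ Finset.range (n + 1), ε ^ i • (psumSucc K i * c (n - i))

lemma isGen_hNat [CharZero K] : IsGen 1 (hNat K) where
  zero := by rw [hNat]
  succ n := by
    rw [hNat, smul_inv_smul₀ (Nat.cast_ne_zero.2 n.succ_ne_zero),
      Finset.sum_range fun i => (1 : K) ^ i • (psumSucc K i * hNat K (n - i))]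
    simp

lemma isGen_eNat [CharZero K] : IsGen (-1) (eNat K) where
  zero := by rw [eNat]
  succ n := by
    rw [eNat, smul_inv_smul₀ (Nat.cast_ne_zero.2 n.succ_ne_zero),
      Finset.sum_range fun i => (-1 : K) ^ i • (psumSucc K i * eNat K (n - i))]

/-- The series `∑ ε^i p_{i+1} w^i`. -/
def psumSeries (ε : K) : PowerSeries (Lam K) := PowerSeries.mk fun i => ε ^ i • psumSucc K i

lemma IsGen.derivative {ε : K} {c : ℕ → Lam K} (hc : IsGen ε c) :
    PowerSeries.derivative _ (PowerSeries.mk c) = psumSeries ε * PowerSeries.mk c := by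
  ext1 n
  have h := hc.succ n
  rw [Algebra.smul_def, map_natCast, mul_comm] at h
  rw [PowerSeries.coeff_derivative, PowerSeries.coeff_mk, PowerSeries.coeff_mul,
    Finset.Nat.sum_antidiagonal_eq_sum_range_succ_mk]
  simp only [psumSeries, PowerSeries.coeff_mk, smul_mul_assoc]
  exact_mod_cast h

lemma derivative_map {A B : Type*} [CommRing A] [CommRing B] (φ : A →+* B) (F : PowerSeries A) :
    PowerSeries.derivative _ (PowerSeries.map φ F) =
      PowerSeries.map φ (PowerSeries.derivative _ F) := by
  ext n
  simp [PowerSeries.coeff_derivative]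

/-- The generating series is `F = exp(∑ ε^{n-1} pₙ wⁿ / n)`, so `n ∂/∂pₙ` multiplies it by `ε^{n-1}
wⁿ`. Formally, `G` and `H` have zero constant term and solve the same linear differential equation,
so they agree. -/
lemma IsGen.skew_X [CharZero K] {ε : K} {c : ℕ → Lam K} (hc : IsGen ε c) (n : ℕ+) (k : ℕ) :
    skew K (X n) (c k) = if (n : ℕ) ≤ k then ε ^ n.natPred • c (k - n) else 0 := by
  set F := PowerSeries.mk c with hF
  set G := PowerSeries.mk fun k => skew K (X n) (c k) with hG
  set H : PowerSeries (Lam K) := PowerSeries.C (C (ε ^ n.natPred)) * PowerSeries.X ^ (n : ℕ) * F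
    with hH
  have hn : n.natPred + 1 = n := PNat.natPred_add_one n
  have hdG : PowerSeries.derivative _ G =
      PowerSeries.C (C ((n : ℕ) * ε ^ n.natPred)) * PowerSeries.X ^ n.natPred * F +
        psumSeries ε * G := by
    have h1 : PowerSeries.mk (fun i => skew K (X n) (ε ^ i • psumSucc K i)) =
        PowerSeries.C (C ((n : ℕ) * ε ^ n.natPred)) * PowerSeries.X ^ n.natPred := by
      ext1 i
      rw [PowerSeries.coeff_mk, map_smul, psumSucc, skew_X_X, PowerSeries.coeff_C_mul,
        PowerSeries.coeff_X_pow]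
      by_cases hi : i = n.natPred
      · subst hi
        simp [Algebra.smul_def, mul_comm]
      · rw [if_neg, if_neg hi, smul_zero, mul_zero]
        rintro rfl
        simp at hi
    rw [← h1]
    ext1 k
    have h2 := congrArg (fun s => skew K (X n) (PowerSeries.coeff k s)) hc.derivative
    simp only [PowerSeries.coeff_derivative, PowerSeries.coeff_mk, PowerSeries.coeff_mul,
      psumSeries, map_sum, skew_X_mul] at h2
    rw [PowerSeries.coeff_derivative, map_add, PowerSeries.coeff_mul, PowerSeries.coeff_mul,
      ← Finset.sum_add_distrib]
    simp only [psumSeries, hF, hG, PowerSeries.coeff_mk]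
    rw [← h2]
    -- The factor `k + 1` from differentiating in `w` is a scalar, so the derivation `pₙ^⊥` kills
    -- it.
    have h3 : ((k : Lam K) + 1) = C ((k : K) + 1) := by simp
    rw [h3, RibbonOps.skew_X n (C _), pderiv_C, smul_zero, mul_zero, add_zero]
  have hdH : PowerSeries.derivative _ H =
      PowerSeries.C (C ((n : ℕ) * ε ^ n.natPred)) * PowerSeries.X ^ n.natPred * F +
        psumSeries ε * H := by
    rw [hH, Derivation.leibniz, Derivation.leibniz, PowerSeries.derivative_C,
      PowerSeries.derivative_pow, PowerSeries.derivative_X, hF, hc.derivative]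
    have hn' : (n : ℕ) - 1 = n.natPred := rfl
    simp only [smul_eq_mul, map_mul, map_natCast, map_pow, hn']
    ring
  have hGH : G - H = 0 := by
    refine eq_zero_of_derivative_eq_mul (K := K) (psumSeries ε) _ ?_ ?_
    · have : skew K (X n) (1 : Lam K) = 0 := by rw [RibbonOps.skew_X]; simp
      rw [map_sub, hG, PowerSeries.coeff_mk, hc.zero, this, hH]
      simp
    · rw [map_sub, hdG, hdH]
      ring
  have h := congrArg (PowerSeries.coeff k) (sub_eq_zero.1 hGH)
  rw [hG, hH, PowerSeries.coeff_mk, mul_assoc, PowerSeries.coeff_C_mul,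
    PowerSeries.coeff_X_pow_mul', hF] at h
  rw [h]
  split_ifs
  · rw [PowerSeries.coeff_mk, smul_eq_C_mul]
  · rw [mul_zero]

/-- Additive changes of the power sums act multiplicatively on the generating series. -/
lemma IsGen.map_add [CharZero K] {ε : K} {c : ℕ → Lam K} (hc : IsGen ε c) {A : Type*} [CommRing A]
    [Algebra K A] (φ φ₁ φ₂ : Lam K →ₐ[K] A) (h : ∀ n, φ (X n) = φ₁ (X n) + φ₂ (X n)) (n : ℕ) :
    φ (c n) = ∑ i ∈ Finset.range (n + 1), φ₁ (c i) * φ₂ (c (n - i)) := by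
  set F := PowerSeries.mk c with hF
  have hd : ∀ ψ : Lam K →ₐ[K] A, PowerSeries.derivative _ (PowerSeries.map (ψ : Lam K →+* A) F) =
      PowerSeries.map (ψ : Lam K →+* A) (psumSeries ε) * PowerSeries.map (ψ : Lam K →+* A) F := by
    intro ψ
    rw [derivative_map, hc.derivative, map_mul]
  have hp : PowerSeries.map (φ : Lam K →+* A) (psumSeries ε) =
      PowerSeries.map (φ₁ : Lam K →+* A) (psumSeries ε) +
        PowerSeries.map (φ₂ : Lam K →+* A) (psumSeries ε) := by
    ext i
    simp [psumSeries, psumSucc, h]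
  have key : PowerSeries.map (φ : Lam K →+* A) F -
      PowerSeries.map (φ₁ : Lam K →+* A) F * PowerSeries.map (φ₂ : Lam K →+* A) F = 0 := by
    refine eq_zero_of_derivative_eq_mul (K := K)
      (PowerSeries.map (φ : Lam K →+* A) (psumSeries ε)) _ ?_ ?_
    · have h0 : ∀ ψ : Lam K →ₐ[K] A,
          PowerSeries.constantCoeff (PowerSeries.map (ψ : Lam K →+* A) F) = 1 := by
        intro ψ
        rw [← PowerSeries.coeff_zero_eq_constantCoeff_apply, PowerSeries.coeff_map, hF,
          PowerSeries.coeff_mk, hc.zero, map_one]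
      rw [PowerSeries.coeff_zero_eq_constantCoeff_apply, map_sub, map_mul, h0, h0, h0, mul_one,
        sub_self]
    · rw [map_sub, Derivation.leibniz, hd, hd, hd, hp, smul_eq_mul, smul_eq_mul]
      ring
  have := congrArg (PowerSeries.coeff n) (sub_eq_zero.1 key)
  rw [PowerSeries.coeff_mul, Finset.Nat.sum_antidiagonal_eq_sum_range_succ_mk] at this
  simpa [hF] using this

/-! ### Skewing by complete and elementary functions as extraction of coefficients -/

/-- The substitution `pₙ ↦ pₙ + ε^{n-1} uⁿ`, a polynomial in `u`. -/
def shift (ε : K) : Lam K →ₐ[K] Polynomial (Lam K) :=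
  aeval fun n => Polynomial.C (X n) + ε ^ n.natPred • Polynomial.X ^ (n : ℕ)

/-- The operators `c_k^⊥` are the coefficients of the substitution `shift ε`. -/
lemma IsGen.skew_eq_coeff_shift [CharZero K] {ε : K} {c : ℕ → Lam K} (hc : IsGen ε c)
    (hw : ∀ k, IsWeightedHomogeneous wt (c k) k) (k : ℕ) (P : Lam K) :
    skew K (c k) P = (shift ε P).coeff k := by
  induction P using MvPolynomial.induction_on generalizing k with
  | C a =>
    rw [← mul_one (C a), ← smul_eq_C_mul, map_smul, map_smul, map_one (shift ε),
      Polynomial.coeff_smul, Polynomial.coeff_one]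
    congr 1
    cases k with
    | zero => simp [hc.zero, skew_one]
    | succ k =>
      rw [if_neg (Nat.succ_ne_zero k)]
      exact skew_eq_zero_of_lt _ _ (hw _) 0 (by simp)
  | add p q hp hq => rw [_root_.map_add, hp, hq, _root_.map_add, Polynomial.coeff_add]
  -- Both sides obey the same recursion under multiplication by `pₙ`: the correction `(pₙ^⊥ c_k)^⊥ =
  -- ε^{n-1} c_{k-n}^⊥` matches the summand `ε^{n-1} uⁿ` of the substitution.
  | mul_X p n hp =>
    rw [mul_comm, skew_mul_X, hp, map_mul, shift, aeval_X, ← shift, add_mul, Polynomial.coeff_add,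
      Polynomial.coeff_C_mul, hc.skew_X, smul_mul_assoc, Polynomial.coeff_smul,
      Polynomial.coeff_X_pow_mul']
    split_ifs with h
    · rw [map_smul, LinearMap.smul_apply, hp]
    · simp

lemma skew_hNat [CharZero K] (k : ℕ) (P : Lam K) :
    skew K (hNat K k) P = (shift 1 P).coeff k :=
  isGen_hNat.skew_eq_coeff_shift hNat_homogeneous k P

lemma skew_eNat [CharZero K] (k : ℕ) (P : Lam K) :
    skew K (eNat K k) P = (shift (-1) P).coeff k :=
  isGen_eNat.skew_eq_coeff_shift eNat_homogeneous k P

lemma exists_skew_hNat_eq_zero [CharZero K] (P : Lam K) :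
    ∃ N, ∀ k, N ≤ k → skew K (hNat K k) P = 0 :=
  ⟨(shift 1 P).natDegree + 1, fun k hk => by
    rw [skew_hNat, Polynomial.coeff_eq_zero_of_natDegree_lt (by omega)]⟩

lemma exists_skew_eNat_eq_zero [CharZero K] (P : Lam K) :
    ∃ N, ∀ k, N ≤ k → skew K (eNat K k) P = 0 :=
  ⟨(shift (-1) P).natDegree + 1, fun k hk => by
    rw [skew_eNat, Polynomial.coeff_eq_zero_of_natDegree_lt (by omega)]⟩

lemma hInt_natCast (n : ℕ) : hInt K n = hNat K n := by simp [hInt]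

lemma eInt_natCast (n : ℕ) : eInt K n = eNat K n := by simp [eInt]

lemma hInt_neg {n : ℤ} (h : n < 0) : hInt K n = 0 := by rw [hInt, if_neg (by omega)]

lemma eInt_neg {n : ℤ} (h : n < 0) : eInt K n = 0 := by rw [eInt, if_neg (by omega)]

/-- The added terms `(-1)^{n-1} uⁿ` contribute the factor `exp(∑ (-1)^{n-1} (uw)ⁿ / n) = 1 + uw` to
the generating series of the `hₙ`. -/
lemma shift_neg_one_hNat [CharZero K] (n : ℕ) :
    shift (-1) (hNat K n) =
      Polynomial.C (hInt K n) + Polynomial.X * Polynomial.C (hInt K (n - 1)) := by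
  set φ₂ : Lam K →ₐ[K] Polynomial (Lam K) :=
    aeval fun n => (-1 : K) ^ n.natPred • (Polynomial.X : Polynomial (Lam K)) ^ (n : ℕ) with hφ₂
  have h2 : ∀ k, φ₂ (hNat K k) = if k = 0 then 1 else if k = 1 then Polynomial.X else 0 := by
    intro k
    induction k using Nat.strong_induction_on with
    | _ k ih =>
    rcases k with _ | k
    · simp [isGen_hNat.zero]
    have h := congrArg φ₂ (isGen_hNat.succ k)
    simp only [map_smul, one_pow, one_smul, map_sum, map_mul] at h
    rw [← inv_smul_smul₀ (Nat.cast_ne_zero.2 k.succ_ne_zero : ((k + 1 : ℕ) : K) ≠ 0)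
      (φ₂ (hNat K (k + 1))), h]
    have hps : ∀ i, φ₂ (psumSucc K i) = (-1 : K) ^ i • Polynomial.X ^ (i + 1) := by
      intro i; simp [hφ₂, psumSucc]
    rcases k with _ | k
    · simp [hps, isGen_hNat.zero]
    -- Only the terms with `h_0` and `h_1` survive in the recursion, and they cancel.
    · rw [Finset.sum_range_succ, Finset.sum_range_succ, Finset.sum_eq_zero, hps, hps,
        ih _ (by omega), ih _ (by omega)]
      · simp [show k + 1 - k = 1 by omega, pow_succ]
      · intro i hi
        rw [Finset.mem_range] at hi
        rw [ih _ (by omega), if_neg (by omega), if_neg (by omega), mul_zero]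
  have h1 : ∀ f : Lam K, (Algebra.ofId (Lam K) (Polynomial (Lam K))).restrictScalars K f =
    Polynomial.C f := fun f => rfl
  rw [isGen_hNat.map_add (shift (-1))
    ((Algebra.ofId (Lam K) (Polynomial (Lam K))).restrictScalars K) φ₂ ?_ n]
  · simp only [h1, h2]
    rcases n with _ | n
    · simp [hInt]
    · rw [Finset.sum_range_succ, Finset.sum_range_succ, Finset.sum_eq_zero]
      · simp [show n + 1 - n = 1 by omega, hInt_natCast]
        have := hInt_natCast (K := K) (n + 1)
        push_cast at this
        rw [this]
        ring
      · intro i hi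
        rw [Finset.mem_range] at hi
        rw [if_neg (by omega), if_neg (by omega), mul_zero]
  · intro n
    simp [shift, hφ₂, h1]

lemma shift_neg_one_hInt [CharZero K] (n : ℤ) :
    shift (-1) (hInt K n) =
      Polynomial.C (hInt K n) + Polynomial.X * Polynomial.C (hInt K (n - 1)) := by
  rcases lt_or_ge n 0 with h | h
  · rw [hInt_neg h, hInt_neg (by omega)]; simp
  · lift n to ℕ using h
    rw [hInt_natCast, shift_neg_one_hNat, hInt_natCast]

/-! ### The antipode -/

/-- The antipode `pₙ ↦ -pₙ`. -/
def antipode : Lam K →ₐ[K] Lam K := aeval fun n => -X n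

lemma antipode_antipode (f : Lam K) : antipode (antipode f) = f := by
  have : (antipode (K := K)).comp antipode = AlgHom.id K _ := by
    ext n : 1
    simp [antipode]
  exact DFunLike.congr_fun this f

lemma antipode_hNat [CharZero K] (n : ℕ) : antipode (hNat K n) = (-1 : K) ^ n • eNat K n := by
  induction n using Nat.strong_induction_on with
  | _ n ih =>
  rcases n with _ | n
  · simp [isGen_hNat.zero, isGen_eNat.zero]
  have h0 : ((n + 1 : ℕ) : K) ≠ 0 := Nat.cast_ne_zero.2 n.succ_ne_zero
  rw [← inv_smul_smul₀ h0 (hNat K (n + 1)), ← inv_smul_smul₀ h0 (eNat K (n + 1)), isGen_hNat.succ,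
    isGen_eNat.succ, map_smul, smul_comm]
  congr 1
  rw [map_sum, Finset.smul_sum]
  refine Finset.sum_congr rfl fun i hi => ?_
  rw [Finset.mem_range] at hi
  rw [one_pow, one_smul, map_mul, ih _ (by omega), psumSucc, antipode, aeval_X, mul_smul_comm,
    smul_smul, neg_mul, smul_neg, ← neg_smul]
  congr 1
  obtain ⟨j, rfl⟩ : ∃ j, n = i + j := Nat.exists_eq_add_of_le (by omega)
  rw [Nat.add_sub_cancel_left, ← pow_add, show i + j + 1 + i = 2 * i + (j + 1) by ring, pow_add,
    pow_mul]
  simp [pow_succ]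

lemma antipode_eNat [CharZero K] (n : ℕ) : antipode (eNat K n) = (-1 : K) ^ n • hNat K n := by
  have h := congrArg antipode (antipode_hNat (K := K) n)
  rw [antipode_antipode, map_smul] at h
  rw [h, smul_smul, ← mul_pow]
  simp

/-! ### Bernstein's operators -/

lemma vertex_apply (c g : ℕ → Lam K) (hg : ∀ k, IsWeightedHomogeneous wt (g k) k) (P : Lam K)
    (N : ℕ) (hN : ∀ k, N ≤ k → skew K (g k) P = 0) :
    vertex c g hg P = ∑ k ∈ Finset.range N, (-1 : K) ^ k • (c k * skew K (g k) P) := by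
  refine finsum_eq_sum_of_support_subset _ fun k hk => ?_
  by_contra h
  simp only [Finset.coe_range, Set.mem_Iio, not_lt] at h
  exact hk (by simp [hN k h])

lemma bernstein_apply (m : ℤ) (P : Lam K) (N : ℕ) (hN : ∀ k, N ≤ k → skew K (eNat K k) P = 0) :
    bernstein K m P =
      ∑ k ∈ Finset.range N, (-1 : K) ^ k • (hInt K (m + k) * skew K (eNat K k) P) :=
  vertex_apply _ _ _ P N hN

lemma bernsteinCol_apply (m : ℤ) (P : Lam K) (N : ℕ)
    (hN : ∀ k, N ≤ k → skew K (hNat K k) P = 0) :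
    bernsteinCol K m P =
      ∑ k ∈ Finset.range N, (-1 : K) ^ k • (eInt K (m + k) * skew K (hNat K k) P) :=
  vertex_apply _ _ _ P N hN

lemma skew_eNat_zero [CharZero K] (P : Lam K) : skew K (eNat K 0) P = P := by
  rw [isGen_eNat.zero, skew_one, Module.End.one_apply]

lemma skew_eNat_succ_hInt_mul [CharZero K] (k : ℕ) (j : ℤ) (Q : Lam K) :
    skew K (eNat K (k + 1)) (hInt K j * Q) =
      hInt K j * skew K (eNat K (k + 1)) Q + hInt K (j - 1) * skew K (eNat K k) Q := by
  simp only [skew_eNat]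
  rw [map_mul, shift_neg_one_hInt, add_mul, Polynomial.coeff_add, Polynomial.coeff_C_mul,
    mul_assoc, Polynomial.coeff_X_mul, Polynomial.coeff_C_mul]

/-- Since `e_k^⊥ (h_j Q) = h_j e_k^⊥ Q + h_{j-1} e_{k-1}^⊥ Q`, the second terms reassemble after a
shift of `k`, which raises the index of `S` and changes the sign. -/
lemma bernstein_hInt_mul [CharZero K] (m j : ℤ) (Q : Lam K) :
    bernstein K m (hInt K j * Q) =
      hInt K j * bernstein K m Q - hInt K (j - 1) * bernstein K (m + 1) Q := by
  obtain ⟨N, hN⟩ := exists_skew_eNat_eq_zero Q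
  rw [bernstein_apply m (hInt K j * Q) (N + 1), bernstein_apply m Q (N + 1),
    bernstein_apply _ Q N hN, Finset.sum_range_succ', Finset.sum_range_succ' _ N, mul_add, Finset.mul_sum, Finset.mul_sum,
    skew_eNat_zero, skew_eNat_zero, add_sub_right_comm, ← Finset.sum_sub_distrib]
  · congr 1
    · refine Finset.sum_congr rfl fun k _ => ?_
      rw [skew_eNat_succ_hInt_mul, show m + ((k + 1 : ℕ) : ℤ) = m + 1 + k by push_cast; ring,
        pow_succ]
      simp only [smul_eq_C_mul, map_mul, map_neg, map_one]
      ring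
    · simp [mul_left_comm]
  · exact fun k hk => hN k (by omega)
  · intro k hk
    obtain ⟨k, rfl⟩ : ∃ i, k = i + 1 := Nat.exists_eq_succ_of_ne_zero (by omega)
    rw [skew_eNat_succ_hInt_mul, hN _ (by omega), hN _ (by omega), mul_zero, mul_zero, add_zero]

/-- Moving all skewings to the right gives `S_m S_n = B(m, n) - B(m+1, n-1)`, where `B(m, n) = ∑
(-1)^{k+l} h_{m+k} h_{n+l} e_k^⊥ e_l^⊥` is symmetric in `m` and `n`. -/
lemma bernstein_bernstein [CharZero K] (m n : ℤ) :
    bernstein K m * bernstein K n = -(bernstein K (n - 1) * bernstein K (m + 1)) := by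
  refine LinearMap.ext fun P => ?_
  obtain ⟨N, hN⟩ := exists_skew_eNat_eq_zero P
  set B : ℤ → ℤ → Lam K := fun m n => ∑ l ∈ Finset.range N, ∑ k ∈ Finset.range N,
    (-1 : K) ^ l • (hInt K (n + l) *
      ((-1 : K) ^ k • (hInt K (m + k) * skew K (eNat K k) (skew K (eNat K l) P)))) with hB
  have hB_comm : ∀ m n, B m n = B n m := by
    intro m n
    rw [hB]
    dsimp only
    rw [Finset.sum_comm]
    refine Finset.sum_congr rfl fun k _ => Finset.sum_congr rfl fun l _ => ?_
    rw [skew_comm_apply]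
    simp only [smul_eq_C_mul]
    ring
  have hS : ∀ m n, bernstein K m (bernstein K n P) = B m n - B (m + 1) (n - 1) := by
    intro m n
    rw [bernstein_apply n P N hN, map_sum, hB]
    dsimp only
    rw [← Finset.sum_sub_distrib]
    refine Finset.sum_congr rfl fun l _ => ?_
    have hl : ∀ k, N ≤ k → skew K (eNat K k) (skew K (eNat K l) P) = 0 := fun k hk => by
      rw [skew_comm_apply, hN k hk, map_zero]
    rw [map_smul, bernstein_hInt_mul, bernstein_apply m _ N hl, bernstein_apply (m + 1) _ N hl,
      smul_sub, Finset.mul_sum, Finset.mul_sum, Finset.smul_sum, Finset.smul_sum,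
      show n - 1 + (l : ℤ) = n + l - 1 by ring]
  rw [LinearMap.neg_apply, Module.End.mul_apply, Module.End.mul_apply, hS, hS, hB_comm m n,
    hB_comm (m + 1), sub_add_cancel, add_sub_cancel_right, neg_sub]

/-! ### Bernstein's operators add a row to a Jacobi-Trudi determinant -/

/-- The Jacobi-Trudi determinant of a sequence of integers. -/
def jacobiTrudi {l : ℕ} (α : Fin l → ℤ) : Lam K :=
  Matrix.det (Matrix.of fun i j : Fin l => hInt K (α i - (i : ℤ) + (j : ℤ)))

lemma shift_jacobiTrudi [CharZero K] {l : ℕ} (α : Fin l → ℤ) :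
    shift (-1) (jacobiTrudi (K := K) α) =
      ∑ k : Fin (l + 1), Polynomial.X ^ (k : ℕ) * Polynomial.C (Matrix.det (Matrix.of
        fun i j : Fin l => hInt K (α i - ((i : ℤ) + 1) + (k.succAbove j : ℕ)))) := by
  set A : Matrix (Fin (l + 1)) (Fin (l + 1)) (Polynomial (Lam K)) := Matrix.of
    (Fin.cons (fun j => (-Polynomial.X) ^ (j : ℕ))
      fun i j => Polynomial.C (hInt K (α i - ((i : ℤ) + 1) + (j : ℤ)))) with hA
  set B : Matrix (Fin (l + 1)) (Fin (l + 1)) (Polynomial (Lam K)) := Matrix.of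
    (Fin.cons (Fin.cons 1 fun _ => 0)
      fun i => Fin.cons (A i.succ 0)
        fun j => shift (-1) (hInt K (α i - (i : ℤ) + (j : ℤ)))) with hB
  -- Adding `u` times the preceding column of `A` to each later column clears the first row `1, -u,
  -- u², …` beyond its first entry and replaces `h_r` by `h_r + u h_{r-1}`, its image under the
  -- substitution.
  have hAB : A.det = B.det := by
    refine Matrix.det_eq_of_forall_col_eq_smul_add_pred (fun _ => -Polynomial.X) ?_ ?_
    · intro i
      refine Fin.cases ?_ (fun i => ?_) i
      · simp [hA, hB]
      · simp [hB]
    · intro i j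
      refine Fin.cases ?_ (fun i => ?_) i
      · simp [hA, hB, pow_succ']
      · simp only [hA, hB, Matrix.of_apply, Fin.cons_succ, shift_neg_one_hInt, Fin.val_succ,
          Fin.val_castSucc]
        rw [show α i - ((i : ℤ) + 1) + ((j + 1 : ℕ) : ℤ) = α i - i + j by push_cast; ring,
          show α i - ((i : ℤ) + 1) + (j : ℤ) = α i - i + j - 1 by ring]
        ring
  have hBdet : B.det = shift (-1) (jacobiTrudi (K := K) α) := by
    rw [Matrix.det_succ_row_zero, Fin.sum_univ_succ, Finset.sum_eq_zero, jacobiTrudi,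
      AlgHom.map_det]
    · simp only [hB, Matrix.of_apply, Fin.cons_zero, Fin.val_zero, pow_zero, mul_one, one_mul,
        add_zero]
      congr 1
    · intro j _
      simp [hB]
  rw [← hBdet, ← hAB, Matrix.det_succ_row_zero]
  refine Finset.sum_congr rfl fun k _ => ?_
  rw [Polynomial.C.map_det]
  simp only [hA, Matrix.of_apply, Fin.cons_zero]
  rw [← mul_pow]
  congr 1
  exact congrArg (· ^ (k : ℕ))
    (by ring : (-1 * -Polynomial.X : Polynomial (Lam K)) = Polynomial.X)

/-- The function `e_k^⊥` of the determinant is the minor of the enlarged matrix without its first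
row and its column `k`, so the sum defining `S_m` is the Laplace expansion along the new row. -/
lemma bernstein_jacobiTrudi [CharZero K] {l : ℕ} (m : ℤ) (α : Fin l → ℤ) :
    bernstein K m (jacobiTrudi α) = jacobiTrudi (Fin.cons m α : Fin (l + 1) → ℤ) := by
  have hs : ∀ k : ℕ, skew K (eNat K k) (jacobiTrudi α) = if h : k < l + 1 then
      Matrix.det (Matrix.of fun i j : Fin l =>
        hInt K (α i - ((i : ℤ) + 1) + ((⟨k, h⟩ : Fin (l + 1)).succAbove j : ℕ))) else 0 := by
    intro k
    rw [skew_eNat, shift_jacobiTrudi, Polynomial.finsetSum_coeff]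
    simp only [Polynomial.coeff_X_pow_mul', Polynomial.coeff_C, Nat.sub_eq_zero_iff_le]
    split_ifs with h
    · rw [Finset.sum_eq_single ⟨k, h⟩]
      · simp
      · intro b _ hb
        have : (b : ℕ) ≠ k := fun h' => hb (Fin.ext h')
        split_ifs <;> first | rfl | omega
      · simp
    · refine Finset.sum_eq_zero fun b _ => ?_
      have := b.2
      split_ifs <;> first | rfl | omega
  rw [bernstein_apply m _ (l + 1) fun k hk => by rw [hs, dif_neg (by omega)], Finset.sum_range,
    jacobiTrudi.eq_def (Fin.cons m α : Fin (l + 1) → ℤ), Matrix.det_succ_row_zero]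
  refine Finset.sum_congr rfl fun k _ => ?_
  rw [hs, dif_pos k.2, smul_eq_C_mul, ← mul_assoc]
  congr 2
  · simp
  · ext i
    simp

/-! ### The hat of an operator -/

lemma hat_apply (V : Op K) (P : Lam K) :
    hat V P = LinearMap.mul' K (Lam K) (V.lTensor (Lam K) (subDiff (K := K) P)) := rfl

lemma hat_add (V W : Op K) : hat (V + W) = hat V + hat W := by
  rw [hat, LinearMap.lTensor_add, LinearMap.add_comp, LinearMap.comp_add]; rfl

lemma hat_smul (r : K) (V : Op K) : hat (r • V) = r • hat V := by
  rw [hat, LinearMap.lTensor_smul, LinearMap.smul_comp, LinearMap.comp_smul]; rfl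

lemma hat_sum {ι : Type*} (s : Finset ι) (V : ι → Op K) :
    hat (∑ i ∈ s, V i) = ∑ i ∈ s, hat (V i) :=
  map_sum (⟨⟨hat, hat_add⟩, hat_smul⟩ : Op K →ₗ[K] Op K) V s

lemma subDiff_X (n : ℕ+) : subDiff (K := K) (X n : Lam K) =
    (X n : Lam K) ⊗ₜ[K] (1 : Lam K) - (1 : Lam K) ⊗ₜ[K] (X n : Lam K) := by
  rw [subDiff, aeval_X]

/-- The hat is an involution. -/
lemma hat_hat (V : Op K) : hat (hat V) = V := by
  -- the substitution `P[X] ↦ P[X - (X - Y)] = P[Y]`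
  let m : Lam K ⊗[K] (Lam K ⊗[K] Lam K) →ₐ[K] Lam K ⊗[K] Lam K :=
    Algebra.TensorProduct.lift Algebra.TensorProduct.includeLeft (AlgHom.id K _)
      fun _ _ => Commute.all _ _
  have hm : ((m.comp (Algebra.TensorProduct.map (AlgHom.id K (Lam K)) subDiff)).comp subDiff) =
      Algebra.TensorProduct.includeRight := by
    ext n : 1
    simp [m, subDiff_X, TensorProduct.tmul_sub]
  -- Applying the hat of `V` in the right factor means splitting that factor into two alphabets,
  -- letting `V` act on the second, and multiplying the first into the left factor, as `m` does.
  have h1 : ∀ t : Lam K ⊗[K] Lam K, LinearMap.mul' K (Lam K) ((hat V).lTensor (Lam K) t) =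
      LinearMap.mul' K (Lam K) (V.lTensor (Lam K)
        (m (Algebra.TensorProduct.map (AlgHom.id K (Lam K)) subDiff t))) := by
    intro t
    induction t with
    | zero => simp
    | add x y hx hy => simp only [map_add, hx, hy]
    | tmul x y =>
      rw [LinearMap.lTensor_tmul, LinearMap.mul'_apply, hat_apply, Algebra.TensorProduct.map_tmul]
      generalize subDiff (K := K) y = s
      induction s with
      | zero => simp
      | add a b ha hb => simp only [map_add, mul_add, TensorProduct.tmul_add, ha, hb]
      | tmul a b => simp [m, mul_assoc]
  refine LinearMap.ext fun P => ?_
  rw [hat_apply, h1, show m (Algebra.TensorProduct.map (AlgHom.id K (Lam K)) subDiff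
    (subDiff (K := K) P)) = 1 ⊗ₜ P from DFunLike.congr_fun hm P]
  simp

/-- Chain rule: `pₙ[X - Y]` has derivative `-1` with respect to `pₙ[Y]`. -/
lemma lTensor_skew_X_subDiff [CharZero K] (n : ℕ+) (P : Lam K) :
    (skew K (X n)).lTensor (Lam K) (subDiff (K := K) P) = -subDiff (K := K) (skew K (X n) P) := by
  have hmul : ∀ (a : Lam K) (t : Lam K ⊗[K] Lam K),
      (skew K (X n)).lTensor (Lam K) ((1 ⊗ₜ a) * t) =
        (1 ⊗ₜ skew K (X n) a) * t + (1 ⊗ₜ a) * (skew K (X n)).lTensor (Lam K) t := by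
    intro a t
    induction t with
    | zero => simp
    | add x y hx hy => simp only [mul_add, map_add, hx, hy]; abel
    | tmul x y => simp [skew_X_mul, TensorProduct.tmul_add]
  have hmul' : ∀ (a : Lam K) (t : Lam K ⊗[K] Lam K),
      (skew K (X n)).lTensor (Lam K) ((a ⊗ₜ 1) * t) =
        (a ⊗ₜ 1) * (skew K (X n)).lTensor (Lam K) t := by
    intro a t
    induction t with
    | zero => simp
    | add x y hx hy => simp only [mul_add, map_add, hx, hy]
    | tmul x y => simp
  induction P using MvPolynomial.induction_on with
  | C a => simp [skew_X, algHom_C, Algebra.TensorProduct.algebraMap_apply]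
  | add p q hp hq => simp only [map_add, hp, hq, neg_add]
  | mul_X p m hp =>
    rw [mul_comm p, map_mul, skew_X_mul, skew_X_X, map_add subDiff, map_mul subDiff,
      map_mul subDiff, subDiff_X, sub_mul,
      map_sub, hmul, hmul', hp, skew_X_X]
    split_ifs with h
    · rw [map_natCast, show (1 : Lam K) ⊗ₜ[K] ((n : ℕ) : Lam K) = ((n : ℕ) : Lam K ⊗[K] Lam K) from
        map_natCast (Algebra.TensorProduct.includeRight : Lam K →ₐ[K] Lam K ⊗[K] Lam K) n]
      ring
    · rw [map_zero, TensorProduct.tmul_zero]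
      ring

lemma lTensor_skew_subDiff [CharZero K] (g P : Lam K) :
    (skew K g).lTensor (Lam K) (subDiff (K := K) P) = subDiff (K := K) (skew K (antipode g) P) := by
  induction g using MvPolynomial.induction_on generalizing P with
  | C a =>
    rw [← mul_one (C a), ← smul_eq_C_mul, map_smul, map_smul, map_smul, map_one antipode, skew_one]
    simp [Module.End.one_eq_id]
  | add p q hp hq =>
    rw [map_add, LinearMap.lTensor_add, LinearMap.add_apply, hp, hq, map_add, map_add,
      LinearMap.add_apply, map_add]
  | mul_X p n hp =>
    rw [mul_comm, skew_mul, LinearMap.lTensor_mul, Module.End.mul_apply, hp,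
      lTensor_skew_X_subDiff, map_mul, skew_mul, Module.End.mul_apply, antipode, aeval_X,
      ← antipode, map_neg, LinearMap.neg_apply, map_neg]

lemma mul'_subDiff (P : Lam K) :
    LinearMap.mul' K (Lam K) (subDiff (K := K) P) = C (constantCoeff P) := by
  have : (Algebra.TensorProduct.lmul' K (S := Lam K)).comp subDiff =
      (Algebra.ofId K (Lam K)).comp (aeval fun _ : ℕ+ => (0 : K)) := by
    ext n : 1
    simp [subDiff_X]
  have h := DFunLike.congr_fun this P
  simp only [AlgHom.comp_apply, Algebra.ofId_apply, aeval_zero'] at h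
  exact h

/-- Skewing in `Y` passes through the substitution as skewing by the antipode, and then `Y = X`
keeps only the constant term. -/
lemma hat_skew_apply [CharZero K] (g P : Lam K) :
    hat (skew K g) P = C (hall K P (antipode g)) := by
  rw [hat_apply, lTensor_skew_subDiff, mul'_subDiff, constantCoeff_skew]

lemma antipode_skew [CharZero K] (g P : Lam K) :
    antipode (skew K g P) = skew K (antipode g) (antipode P) := by
  induction g using MvPolynomial.induction_on generalizing P with
  | C a =>
    rw [← mul_one (C a), ← smul_eq_C_mul, map_smul, map_smul, map_smul, map_one antipode, skew_one]
    simp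
  | add p q hp hq => simp only [map_add, LinearMap.add_apply, hp, hq]
  | mul_X p n hp =>
    rw [skew_mul, Module.End.mul_apply, hp, map_mul, skew_mul, Module.End.mul_apply]
    congr 1
    induction P using MvPolynomial.induction_on with
    | C a => simp [skew_X, antipode]
    | add p q hp hq => simp only [map_add, hp, hq]
    | mul_X p m hp =>
      rw [skew_X_mul, map_add, map_mul, map_mul, hp, skew_X_X, map_mul]
      simp only [antipode, aeval_X, map_neg, LinearMap.neg_apply, skew_X_mul, skew_X_X]
      split_ifs <;> simp [add_comm]

/-! ### The hat and Bernstein's operators -/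

/-- Terms with `i > n` vanish because `h` has a negative index there, so a single cutoff `M` serves
many `n` at once. -/
lemma subDiff_eInt [CharZero K] (n : ℤ) (M : ℕ) (hM : n < M) :
    subDiff (K := K) (eInt K n) = ∑ i ∈ Finset.range M,
      (-1 : K) ^ (n - i) • (eNat K i ⊗ₜ[K] hInt K (n - i)) := by
  rcases lt_or_ge n 0 with h | h
  · rw [eInt_neg h, map_zero, Finset.sum_eq_zero fun i _ => ?_]
    rw [hInt_neg (by omega), TensorProduct.tmul_zero, smul_zero]
  · lift n to ℕ using h
    rw [eInt_natCast, isGen_eNat.map_add subDiff Algebra.TensorProduct.includeLeft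
      ((Algebra.TensorProduct.includeRight : Lam K →ₐ[K] Lam K ⊗[K] Lam K).comp antipode)
      fun m => by simp [subDiff_X, antipode, sub_eq_add_neg, TensorProduct.tmul_neg]]
    rw [← Finset.sum_range_add_sum_Ico _ (show n + 1 ≤ M by omega),
      Finset.sum_eq_zero (s := Finset.Ico _ _), add_zero]
    · refine Finset.sum_congr rfl fun i hi => ?_
      rw [Finset.mem_range] at hi
      obtain ⟨j, rfl⟩ : ∃ j, n = i + j := Nat.exists_eq_add_of_le (by omega)
      rw [AlgHom.comp_apply, antipode_eNat, Nat.add_sub_cancel_left]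
      simp [hInt_natCast]
    · intro i hi
      rw [Finset.mem_Ico] at hi
      rw [hInt_neg (by omega), TensorProduct.tmul_zero, smul_zero]

lemma exists_bernstein_eq_zero [CharZero K] (P : Lam K) (a : ℤ) :
    ∃ M : ℕ, ∀ i : ℕ, M ≤ i → bernstein K (a - i) P = 0 := by
  obtain ⟨N, hN⟩ := exists_skew_eNat_eq_zero P
  refine ⟨(a + N).toNat, fun i hi => ?_⟩
  rw [bernstein_apply _ P N hN]
  refine Finset.sum_eq_zero fun k hk => ?_
  rw [Finset.mem_range] at hk
  rw [hInt_neg (by omega), zero_mul, smul_zero]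

/-! ### Exchanging `S̃_a` with `S_n` under the hat -/

lemma finite_twist [CharZero K] (a : ℤ) (W : Op K) (P : Lam K) :
    (Function.support fun i : ℕ =>
      (-1 : K) ^ (a - i) • (eNat K i * W (bernstein K (a - i) P))).Finite := by
  obtain ⟨M, hM⟩ := exists_bernstein_eq_zero P a
  refine (Set.finite_lt_nat M).subset fun i hi => ?_
  by_contra h
  exact hi (by simp [hM i (not_lt.1 h)])

/-- The operator `∑_{i ≥ 0} (-1)^{a-i} e_i W S_{a-i}`. -/
def twist [CharZero K] (a : ℤ) (W : Op K) : Op K where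
  toFun P := ∑ᶠ i : ℕ, (-1 : K) ^ (a - i) • (eNat K i * W (bernstein K (a - i) P))
  map_add' P Q := by
    rw [← finsum_add_distrib (finite_twist a W P) (finite_twist a W Q)]
    exact finsum_congr fun k => by rw [map_add, map_add, mul_add, smul_add]
  map_smul' r P := by
    rw [RingHom.id_apply, smul_finsum' r (finite_twist a W P)]
    exact finsum_congr fun k => by rw [map_smul, map_smul, mul_smul_comm, smul_comm]

lemma exists_twist_apply [CharZero K] (a : ℤ) (W : Op K) (P : Lam K) :
    ∃ M₀ : ℕ, ∀ M, M₀ ≤ M → twist a W P = ∑ i ∈ Finset.range M,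
      (-1 : K) ^ (a - i) • (eNat K i * W (bernstein K (a - i) P)) := by
  obtain ⟨M₀, hM⟩ := exists_bernstein_eq_zero P a
  refine ⟨M₀, fun M hMM => finsum_eq_sum_of_support_subset _ fun k hk => ?_⟩
  by_contra h
  simp only [Finset.coe_range, Set.mem_Iio, not_lt] at h
  exact hk (by simp [hM k (by omega)])

lemma exists_lTensor_twist [CharZero K] (a : ℤ) (W : Op K) (t : Lam K ⊗[K] Lam K) :
    ∃ M₀ : ℕ, ∀ M, M₀ ≤ M → LinearMap.mul' K (Lam K) ((twist a W).lTensor (Lam K) t) =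
      ∑ i ∈ Finset.range M, (-1 : K) ^ (a - i) • (eNat K i * LinearMap.mul' K (Lam K)
        (W.lTensor (Lam K) ((bernstein K (a - i)).lTensor (Lam K) t))) := by
  induction t with
  | zero => exact ⟨0, fun M _ => by simp⟩
  | add x y hx hy =>
    obtain ⟨M₁, h₁⟩ := hx
    obtain ⟨M₂, h₂⟩ := hy
    refine ⟨max M₁ M₂, fun M hM => ?_⟩
    rw [map_add, map_add, h₁ M (by omega), h₂ M (by omega), ← Finset.sum_add_distrib]
    exact Finset.sum_congr rfl fun i _ => by simp only [map_add, mul_add, smul_add]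
  | tmul x y =>
    obtain ⟨M₀, h⟩ := exists_twist_apply a W y
    refine ⟨M₀, fun M hM => ?_⟩
    rw [LinearMap.lTensor_tmul, h M hM, LinearMap.mul'_apply, Finset.mul_sum]
    refine Finset.sum_congr rfl fun i _ => ?_
    rw [LinearMap.lTensor_tmul, LinearMap.lTensor_tmul, LinearMap.mul'_apply, mul_smul_comm,
      mul_left_comm]

/-- The cutoff depends only on when `e_k^⊥` kills the right factors, hence is uniform in `m`. -/
lemma exists_lTensor_bernstein [CharZero K] (t : Lam K ⊗[K] Lam K) :
    ∃ N₀ : ℕ, ∀ N, N₀ ≤ N → ∀ m, (bernstein K m).lTensor (Lam K) t =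
      ∑ k ∈ Finset.range N, (-1 : K) ^ k •
        ((1 ⊗ₜ hInt K (m + k)) * (skew K (eNat K k)).lTensor (Lam K) t) := by
  induction t with
  | zero => exact ⟨0, fun M _ => by simp⟩
  | add x y hx hy =>
    obtain ⟨M₁, h₁⟩ := hx
    obtain ⟨M₂, h₂⟩ := hy
    refine ⟨max M₁ M₂, fun M hM m => ?_⟩
    rw [map_add, h₁ M (by omega), h₂ M (by omega), ← Finset.sum_add_distrib]
    exact Finset.sum_congr rfl fun i _ => by simp only [map_add, mul_add, smul_add]
  | tmul x y =>
    obtain ⟨N₀, h⟩ := exists_skew_eNat_eq_zero y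
    refine ⟨N₀, fun N hN m => ?_⟩
    rw [LinearMap.lTensor_tmul, bernstein_apply m y N fun k hk => h k (by omega),
      TensorProduct.tmul_sum]
    refine Finset.sum_congr rfl fun k _ => ?_
    rw [LinearMap.lTensor_tmul, Algebra.TensorProduct.tmul_mul_tmul, one_mul,
      TensorProduct.tmul_smul]

lemma hat_twist [CharZero K] (a : ℤ) (W : Op K) :
    hat (twist a W) = hat W * bernsteinCol K a := by
  refine LinearMap.ext fun P => ?_
  obtain ⟨M₀, hM⟩ := exists_lTensor_twist a W (subDiff (K := K) P)
  obtain ⟨N₁, hN₁⟩ := exists_lTensor_bernstein (subDiff (K := K) P)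
  obtain ⟨N₂, hN₂⟩ := exists_skew_hNat_eq_zero P
  set N := max N₁ N₂
  -- This makes `a + k < M` for all `k < N`, so that every `e_{a+k}[X - Y]` expands over the same
  -- range.
  set M := max M₀ (a + N).toNat
  rw [hat_apply, hM M (le_max_left _ _), Module.End.mul_apply,
    bernsteinCol_apply a P N fun k hk => hN₂ k (by omega), map_sum]
  have h1 : ∀ k ∈ Finset.range N, hat W ((-1 : K) ^ k • (eInt K (a + k) * skew K (hNat K k) P)) =
      ∑ i ∈ Finset.range M, (-1 : K) ^ (a - i) • (eNat K i * LinearMap.mul' K (Lam K)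
        (W.lTensor (Lam K)
          ((1 ⊗ₜ hInt K (a - i + k)) * subDiff (K := K) (skew K (hNat K k) P)))) := by
    intro k hk
    rw [Finset.mem_range] at hk
    rw [map_smul, hat_apply, map_mul, subDiff_eInt (a + k) M (by omega), Finset.sum_mul, map_sum,
      map_sum, Finset.smul_sum]
    refine Finset.sum_congr rfl fun i _ => ?_
    generalize subDiff (K := K) (skew K (hNat K k) P) = t
    rw [smul_mul_assoc, map_smul, map_smul, smul_smul]
    congr 1
    · rw [show a + (k : ℤ) - i = (a - i) + k by ring, zpow_add₀ (by norm_num), zpow_natCast,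
        mul_left_comm, ← mul_pow]
      simp
    · rw [show a + (k : ℤ) - i = (a - i) + k by ring]
      induction t with
      | zero => simp
      | add x y hx hy => simp only [mul_add, map_add, hx, hy]
      | tmul x y => simp [mul_assoc]
  rw [Finset.sum_congr rfl h1, Finset.sum_comm]
  refine Finset.sum_congr rfl fun i _ => ?_
  rw [hN₁ N (le_max_left _ _), map_sum, map_sum, Finset.mul_sum, Finset.smul_sum]
  refine Finset.sum_congr rfl fun k _ => ?_
  rw [lTensor_skew_subDiff, antipode_eNat, map_smul (skew K), LinearMap.smul_apply,
    map_smul subDiff, mul_smul_comm, smul_smul, ← mul_pow]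
  simp

/-- The sign in `S_{a-i} S_n = -S_{n-1} S_{a+1-i}` is absorbed by passing from `(-1)^{a-i}` to
`(-1)^{a+1-i}`. -/
lemma twist_mul_bernstein [CharZero K] (a n : ℤ) (W : Op K) :
    twist a W * bernstein K n = twist (a + 1) (W * bernstein K (n - 1)) := by
  refine LinearMap.ext fun P => ?_
  obtain ⟨M₁, h₁⟩ := exists_twist_apply a W (bernstein K n P)
  obtain ⟨M₂, h₂⟩ := exists_twist_apply (a + 1) (W * bernstein K (n - 1)) P
  rw [Module.End.mul_apply, h₁ _ (le_max_left M₁ M₂), h₂ _ (le_max_right M₁ M₂)]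
  refine Finset.sum_congr rfl fun i _ => ?_
  rw [Module.End.mul_apply, ← Module.End.mul_apply (bernstein K (a - i)), bernstein_bernstein,
    LinearMap.neg_apply, Module.End.mul_apply, map_neg, mul_neg, smul_neg, ← neg_smul,
    show a + 1 - (i : ℤ) = a - i + 1 by ring, zpow_add_one₀ (by norm_num), mul_neg_one]

/-- Right multiplication by `S̃_a` and the conjugate by the hat of right multiplication by `S_n`
commute, up to a shift of the indices. -/
lemma hat_hat_mul_bernstein [CharZero K] (V : Op K) (a n : ℤ) :
    hat (hat (V * bernsteinCol K a) * bernstein K n) =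
      hat (hat V * bernstein K (n - 1)) * bernsteinCol K (a + 1) := by
  -- Writing `V` as the hat of its hat turns `V * S̃_a` into the hat of a twist, which the outer hat
  -- undoes.
  conv_lhs => rw [← hat_hat V, ← hat_twist, hat_hat, twist_mul_bernstein, hat_twist]

/-- The adjoint of `S_{-m}` is `∑ (-1)^k e_k h_{k-m}^⊥`. The antipode turns `S_m f` into the same
sum applied to `f[-X]`, with `k` replaced by `k + m`. -/
lemma hall_bernstein_antipode [CharZero K] (m : ℤ) (f P : Lam K) :
    hall K (bernstein K (-m) P) (antipode f) = hall K P (antipode (bernstein K m f)) := by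
  obtain ⟨N₁, hN₁⟩ := exists_skew_eNat_eq_zero P
  obtain ⟨N₂, hN₂⟩ := exists_skew_eNat_eq_zero f
  have hf : ∀ k, N₂ ≤ k → skew K (hNat K k) (antipode f) = 0 := fun k hk => by
    have := antipode_skew (eNat K k) f
    rw [hN₂ k hk, map_zero, antipode_eNat, map_smul, LinearMap.smul_apply] at this
    exact (smul_eq_zero.1 this.symm).resolve_left (by simp)
  obtain ⟨N₃, hN₃⟩ : ∃ N : ℕ, N = max (max N₁ N₂) (max m.natAbs 1) := ⟨_, rfl⟩
  -- both sides are sums over all integers `k`, cut off at `M`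
  set T : ℤ → K := fun k => (-1 : K) ^ k *
    hall K P (eInt K k * skew K (hInt K (k - m)) (antipode f)) with hT
  have hT0 : ∀ k, k < 0 → T k = 0 := fun k hk => by
    rw [hT]; dsimp only; rw [eInt_neg hk, zero_mul, map_zero, mul_zero]
  have hTm : ∀ k, k < m → T k = 0 := fun k hk => by
    rw [hT]; dsimp only
    rw [hInt_neg (by omega), map_zero, LinearMap.zero_apply, mul_zero, map_zero, mul_zero]
  have hTN : ∀ k : ℕ, N₂ ≤ k → T (k + m) = 0 := fun k hk => by
    rw [hT]; dsimp only
    rw [add_sub_cancel_right, hInt_natCast, hf k hk, mul_zero, map_zero, mul_zero]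
  have hTN' : ∀ k : ℕ, N₁ ≤ k → T k = 0 := fun k hk => by
    rw [hT]; dsimp only
    rw [eInt_natCast, ← hall_skew, hN₁ k hk, map_zero, LinearMap.zero_apply, mul_zero]
  have hL : hall K (bernstein K (-m) P) (antipode f) = ∑ k ∈ Finset.range N₃, T k := by
    rw [bernstein_apply _ P N₃ fun k hk => hN₁ k (by omega), map_sum, LinearMap.sum_apply]
    refine Finset.sum_congr rfl fun k _ => ?_
    rw [map_smul, LinearMap.smul_apply, hall_comm, ← hall_skew, hall_comm, hall_skew, hT]
    dsimp only
    rw [eInt_natCast, zpow_natCast, neg_add_eq_sub, smul_eq_mul]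
  have hR : hall K P (antipode (bernstein K m f)) = ∑ k ∈ Finset.range N₃, T (k + m) := by
    rw [bernstein_apply _ f N₃ fun k hk => hN₂ k (by omega), map_sum, map_sum]
    refine Finset.sum_congr rfl fun k _ => ?_
    rw [map_smul, map_smul, map_mul, antipode_skew, antipode_eNat, hT]
    dsimp only
    rw [add_sub_cancel_right, hInt_natCast, map_smul, LinearMap.smul_apply, mul_smul_comm, map_smul,
      smul_smul, ← mul_pow, neg_mul_neg, one_mul, one_pow, one_smul]
    rcases lt_or_ge (m + k) 0 with h | h
    · rw [hInt_neg h, eInt_neg (by omega)]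
      simp
    · obtain ⟨j, hj⟩ := Int.eq_ofNat_of_zero_le h
      rw [hj, show (k : ℤ) + m = j by omega, hInt_natCast, eInt_natCast, antipode_hNat,
        zpow_natCast, smul_mul_assoc, map_smul, smul_eq_mul]
  have hfin : (∑ᶠ k : ℤ, T k) = ∑ᶠ k : ℤ, T (k + m) :=
    (finsum_comp_equiv (Equiv.addRight m) (f := T)).symm
  have hcast : ∀ F : ℤ → K, (∀ k, k < 0 → F k = 0) → (∀ k : ℕ, N₃ ≤ k → F k = 0) →
      ∑ k ∈ Finset.range N₃, F k = ∑ᶠ k : ℤ, F k := by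
    intro F h0 h1
    rw [finsum_eq_sum_of_support_subset (s := (Finset.range N₃).map Nat.castEmbedding) F]
    · simp
    · intro k hk
      have hk0 : 0 ≤ k := by
        by_contra h
        exact hk (h0 k (by omega))
      lift k to ℕ using hk0
      have : k < N₃ := by
        by_contra h
        exact hk (h1 k (by omega))
      simpa using this
  rw [hL, hR, hcast T hT0 fun k hk => hTN' k (by omega), hfin]
  exact (hcast (fun k => T (k + m)) (fun k hk => hTm _ (by omega))
    fun k hk => hTN k (by omega)).symm

lemma hat_hat_skew_mul_bernstein [CharZero K] (m : ℤ) (f : Lam K) :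
    hat (hat (skew K f) * bernstein K (-m)) = skew K (bernstein K m f) := by
  rw [← hat_hat (skew K (bernstein K m f))]
  congr 1
  refine LinearMap.ext fun P => ?_
  rw [Module.End.mul_apply, hat_skew_apply, hat_skew_apply, hall_bernstein_antipode]

/-- The effect of `V ↦ hat (hat V * S_1)` on a product `f^⊥ S̃_{a₁} ⋯ S̃_{aₙ}`. -/
lemma hat_hat_skew_mul_prod_mul_bernstein [CharZero K] (f : Lam K) (a : ℕ → ℤ) (n : ℕ) (m : ℤ) :
    hat (hat (skew K f * ((List.range n).map fun j => bernsteinCol K (a j)).prod) *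
        bernstein K (n - m)) =
      skew K (bernstein K m f) * ((List.range n).map fun j => bernsteinCol K (a j + 1)).prod := by
  -- Each factor `S̃` that is passed lowers the index of `S` by one, so `n - m` ends at the index
  -- `-m` of the case without columns.
  induction n with
  | zero => simpa using hat_hat_skew_mul_bernstein m f
  | succ n ih =>
    rw [List.range_succ, List.map_append, List.map_append, List.prod_append, List.prod_append,
      ← mul_assoc, ← mul_assoc, ← ih]
    simp only [List.map_cons, List.map_nil, List.prod_cons, List.prod_nil, mul_one]
    rw [hat_hat_mul_bernstein, show ((n + 1 : ℕ) : ℤ) - m - 1 = n - m by push_cast; ring]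

/-! ### Adding a cell to a ribbon -/

lemma mem_ribbonCells {μ : YoungDiagram} {i j : ℕ} :
    (i, j) ∈ ribbonCells μ ↔ (i, j) ∈ μ ∧ (i + 1, j + 1) ∉ μ := by
  rw [ribbonCells, Finset.mem_sdiff, YoungDiagram.mem_cells, YoungDiagram.mem_cells, mem_rc]

lemma rowLen_pos {μ : YoungDiagram} (h : μ ≠ ⊥) : 0 < μ.rowLen 0 := by
  by_contra h0
  refine h (YoungDiagram.ext (Finset.eq_empty_of_forall_notMem ?_))
  rintro ⟨i, j⟩ hij
  rw [YoungDiagram.mem_cells] at hij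
  have := YoungDiagram.mem_iff_lt_rowLen.1 (μ.up_left_mem (Nat.zero_le i) le_rfl hij)
  omega

/-- The Young diagram with the first row repeated. -/
def doubleRow (μ : YoungDiagram) : YoungDiagram where
  cells := (Finset.range (μ.rowLen 0)).image (fun j => (0, j)) ∪
    μ.cells.image fun c => (c.1 + 1, c.2)
  isLowerSet := by
    rintro ⟨i, j⟩ ⟨i', j'⟩ h hc
    obtain ⟨hi, hj⟩ : i' ≤ i ∧ j' ≤ j := h
    simp only [Finset.coe_union, Finset.coe_image, Finset.coe_range, Set.mem_union, Set.mem_image,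
      Set.mem_Iio, Prod.mk.injEq, Finset.mem_coe, YoungDiagram.mem_cells, Prod.exists] at hc ⊢
    have hj0 : j < μ.rowLen 0 := by
      rcases hc with ⟨a, ha, _, rfl⟩ | ⟨a, b, hab, _, rfl⟩
      · exact ha
      · exact YoungDiagram.mem_iff_lt_rowLen.1 (μ.up_left_mem (Nat.zero_le a) le_rfl hab)
    cases i' with
    | zero => exact Or.inl ⟨j', by omega, rfl, rfl⟩
    | succ i' =>
      rcases hc with ⟨a, ha, rfl, rfl⟩ | ⟨a, b, hab, rfl, rfl⟩
      · omega
      · exact Or.inr ⟨i', j', μ.up_left_mem (by omega) hj hab, rfl, rfl⟩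

lemma mem_doubleRow {μ : YoungDiagram} {i j : ℕ} : (i, j) ∈ doubleRow μ ↔ (i - 1, j) ∈ μ := by
  change (i, j) ∈ (doubleRow μ).cells ↔ _
  rw [doubleRow]
  cases i with
  | zero => simp [YoungDiagram.mem_iff_lt_rowLen]
  | succ i => simp

lemma rowLen_doubleRow (μ : YoungDiagram) (i : ℕ) :
    (doubleRow μ).rowLen i = μ.rowLen (i - 1) := by
  refine eq_of_forall_lt_iff fun j => ?_
  rw [← YoungDiagram.mem_iff_lt_rowLen, mem_doubleRow, YoungDiagram.mem_iff_lt_rowLen]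

lemma colLen_doubleRow (μ : YoungDiagram) {j : ℕ} (h : j < μ.rowLen 0) :
    (doubleRow μ).colLen j = μ.colLen j + 1 := by
  refine eq_of_forall_lt_iff fun i => ?_
  rw [← YoungDiagram.mem_iff_lt_colLen, mem_doubleRow]
  have h' := YoungDiagram.mem_iff_lt_colLen.1 (YoungDiagram.mem_iff_lt_rowLen.2 h)
  rw [YoungDiagram.mem_iff_lt_colLen]
  omega

lemma ribbonCells_doubleRow {μ : YoungDiagram} (h : μ ≠ ⊥) : ribbonCells (doubleRow μ) =
    insert (0, μ.rowLen 0 - 1) ((ribbonCells μ).image fun c => (c.1 + 1, c.2)) := by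
  have := rowLen_pos h
  ext ⟨i, j⟩
  rw [mem_ribbonCells, mem_doubleRow, mem_doubleRow, Finset.mem_insert, Finset.mem_image]
  simp only [Prod.mk.injEq, Prod.exists]
  cases i with
  | zero =>
    simp only [Nat.zero_sub, zero_add, Nat.sub_self, YoungDiagram.mem_iff_lt_rowLen, true_and,
      Nat.succ_ne_zero, false_and, and_false, exists_false, or_false]
    omega
  | succ i => simp [mem_ribbonCells]

/-- The Young diagram with the first row enlarged by one cell. -/
def growRow (μ : YoungDiagram) : YoungDiagram where
  cells := insert (0, μ.rowLen 0) μ.cells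
  isLowerSet := by
    rintro ⟨i, j⟩ ⟨i', j'⟩ h hc
    obtain ⟨hi, hj⟩ : i' ≤ i ∧ j' ≤ j := h
    simp only [Finset.coe_insert, Set.mem_insert_iff, Prod.mk.injEq, Finset.mem_coe,
      YoungDiagram.mem_cells] at hc ⊢
    rcases hc with ⟨rfl, rfl⟩ | hc
    · obtain rfl : i' = 0 := by omega
      rw [YoungDiagram.mem_iff_lt_rowLen]
      omega
    · exact Or.inr (μ.up_left_mem hi hj hc)

lemma mem_growRow {μ : YoungDiagram} {i j : ℕ} :
    (i, j) ∈ growRow μ ↔ (i = 0 ∧ j = μ.rowLen 0) ∨ (i, j) ∈ μ := by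
  change (i, j) ∈ (growRow μ).cells ↔ _
  simp [growRow]

lemma rowLen_zero_growRow (μ : YoungDiagram) : (growRow μ).rowLen 0 = μ.rowLen 0 + 1 := by
  refine eq_of_forall_lt_iff fun j => ?_
  rw [← YoungDiagram.mem_iff_lt_rowLen, mem_growRow, YoungDiagram.mem_iff_lt_rowLen]
  omega

lemma colLen_growRow (μ : YoungDiagram) {j : ℕ} (h : j < μ.rowLen 0) :
    (growRow μ).colLen j = μ.colLen j := by
  refine eq_of_forall_lt_iff fun i => ?_
  rw [← YoungDiagram.mem_iff_lt_colLen, mem_growRow, YoungDiagram.mem_iff_lt_colLen]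
  omega

lemma colLen_rowLen_zero_growRow (μ : YoungDiagram) : (growRow μ).colLen (μ.rowLen 0) = 1 := by
  refine eq_of_forall_lt_iff fun i => ?_
  rw [← YoungDiagram.mem_iff_lt_colLen, mem_growRow, YoungDiagram.mem_iff_lt_rowLen]
  have := μ.rowLen_anti 0 i (Nat.zero_le i)
  omega

lemma rc_growRow (μ : YoungDiagram) : rc (growRow μ) = rc μ := by
  refine YoungDiagram.ext (Finset.ext fun ⟨i, j⟩ => ?_)
  simp [YoungDiagram.mem_cells, mem_rc, mem_growRow]

lemma ribbonCells_growRow (μ : YoungDiagram) :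
    ribbonCells (growRow μ) = insert (0, μ.rowLen 0) (ribbonCells μ) := by
  ext ⟨i, j⟩
  rw [Finset.mem_insert, mem_ribbonCells, mem_ribbonCells, mem_growRow, mem_growRow, Prod.mk.injEq]
  have h : i = 0 ∧ j = μ.rowLen 0 → (i + 1, j + 1) ∉ μ := by
    rintro ⟨rfl, rfl⟩ h
    have := YoungDiagram.mem_iff_lt_rowLen.1 (μ.up_left_mem (Nat.zero_le _) le_rfl h)
    omega
  simp only [Nat.succ_ne_zero, false_and, false_or]
  tauto

/-! ### Labels, descents and the two ways to add a last cell -/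

namespace Ribbon

variable {k : ℕ}

lemma mem_cells_last (R : Ribbon k) : (0, R.outer.rowLen 0 - 1) ∈ R.cells := by
  have h0 := rowLen_pos R.outer_ne_bot
  refine mem_ribbonCells.2 ⟨YoungDiagram.mem_iff_lt_rowLen.2 (by omega), fun h => ?_⟩
  have := YoungDiagram.mem_iff_lt_rowLen.1 (R.outer.up_left_mem (Nat.zero_le _) le_rfl h)
  omega

lemma lt_rowLen_of_mem_cells (R : Ribbon k) {c : ℕ × ℕ} (hc : c ∈ R.cells) :
    c.2 < R.outer.rowLen 0 :=
  YoungDiagram.mem_iff_lt_rowLen.1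
    (R.outer.up_left_mem (Nat.zero_le c.1) le_rfl (mem_ribbonCells.1 hc).1)

lemma pos (R : Ribbon k) : 0 < k := by
  rw [← R.card_cells]
  exact Finset.card_pos.2 ⟨_, R.mem_cells_last⟩

lemma card_cells' (R : Ribbon k) : R.cells.card = k := R.card_cells

lemma label_le (R : Ribbon k) (c : ℕ × ℕ) : R.label c ≤ k :=
  (Finset.card_filter_le _ _).trans_eq R.card_cells'

lemma label_last (R : Ribbon k) : R.label (0, R.outer.rowLen 0 - 1) = k := by
  rw [label, Finset.filter_true_of_mem, card_cells']
  intro d hd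
  have := R.lt_rowLen_of_mem_cells hd
  exact ⟨by dsimp only; omega, Nat.zero_le _⟩

lemma fst_eq_zero_of_label (R : Ribbon k) {c : ℕ × ℕ} (h : R.label c = k) : c.1 = 0 := by
  replace h := h.trans R.card_cells'.symm
  rw [label, Finset.card_filter_eq_iff] at h
  exact Nat.le_zero.1 (h _ R.mem_cells_last).2

lemma notMem_descents (R : Ribbon k) : k ∉ R.descents := by
  have := R.pos
  simp only [descents, Finset.mem_filter, Finset.mem_Icc, not_and]
  omega

/-- The descents of a ribbon which arises by adding a new last cell. -/
lemma descents_of_cells_eq_insert (R : Ribbon k) (R' : Ribbon (k + 1)) (s y : ℕ)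
    (hcells : R'.cells = insert (0, y) (R.cells.image fun c => (c.1 + s, c.2)))
    (hy : ∀ c ∈ R.cells, c.2 ≤ y) (hs : ∀ c ∈ R.cells, c.2 < y ∨ 0 < s) :
    R'.descents = if s = 0 then R.descents else R.descents ∪ {k} := by
  have hinj : Function.Injective fun c : ℕ × ℕ => (c.1 + s, c.2) := fun a b h => by
    simp only [Prod.mk.injEq, Nat.add_right_cancel_iff] at h
    exact Prod.ext h.1 h.2
  -- The new cell lies strictly below or strictly to the right of each old cell, so no old label
  -- counts it.
  have hold : ∀ c ∈ R.cells, R'.label (c.1 + s, c.2) = R.label c := by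
    intro c hc
    rw [label, hcells, Finset.filter_insert, if_neg, Finset.filter_image,
      Finset.card_image_of_injective _ hinj, label]
    · simp
    · have := hs c hc
      dsimp only
      omega
  have hnew : R'.label (0, y) = k + 1 := by
    rw [label, Finset.filter_true_of_mem, card_cells']
    intro d hd
    rw [hcells, Finset.mem_insert, Finset.mem_image] at hd
    rcases hd with rfl | ⟨c, hc, rfl⟩
    · simp
    · exact ⟨hy c hc, Nat.zero_le _⟩
  have hk := R.pos
  have hlast := R.label_last
  ext i
  -- The only new pair of consecutive labels is `k, k + 1`. A cell labelled `k` had row `0`, so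
  -- after the lift by `s` it lies above the new cell exactly when `s ≠ 0`.
  have hmem : i ∈ R'.descents ↔ i ∈ R.descents ∨ (i = k ∧ s ≠ 0) := by
    simp only [descents, Finset.mem_filter, Finset.mem_Icc, hcells, Finset.exists_mem_insert,
      Finset.exists_mem_image, hnew, Nat.add_sub_cancel]
    constructor
    · rintro ⟨⟨h1, h2⟩, ((h | ⟨d, hd, h⟩) | ⟨c, hc, (h | ⟨d, hd, h⟩)⟩)⟩
      · omega
      · omega
      · rw [hold c hc] at h
        refine Or.inr ⟨by omega, ?_⟩
        have := R.fst_eq_zero_of_label (c := c) (by omega)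
        omega
      · rw [hold c hc, hold d hd] at h
        have := R.label_le d
        exact Or.inl ⟨by omega, c, hc, d, hd, h.1, h.2.1, by omega⟩
    · rintro (⟨h1, c, hc, d, hd, h⟩ | ⟨rfl, h⟩)
      · refine ⟨by omega, Or.inr ⟨c, hc, Or.inr ⟨d, hd, ?_⟩⟩⟩
        rw [hold c hc, hold d hd]
        exact ⟨h.1, h.2.1, by omega⟩
      · refine ⟨by omega, Or.inr ⟨_, R.mem_cells_last, Or.inl ⟨?_, rfl, ?_⟩⟩⟩
        · rw [hold _ R.mem_cells_last, hlast]
        · dsimp only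
          omega
  rw [hmem]
  split_ifs with h <;> simp [h]
  tauto

/-- The ribbon with one cell added below the last cell. -/
def addBelow (R : Ribbon k) : Ribbon (k + 1) where
  outer := doubleRow R.outer
  outer_ne_bot h := by
    have h1 := rowLen_pos R.outer_ne_bot
    rw [← YoungDiagram.mem_iff_lt_rowLen] at h1
    exact YoungDiagram.notMem_bot (0, 0) (h ▸ mem_doubleRow.2 h1)
  card_cells := by
    rw [ribbonCells_doubleRow R.outer_ne_bot, Finset.card_insert_of_notMem (by simp),
      Finset.card_image_of_injective, R.card_cells]
    intro a b h
    simp only [Prod.mk.injEq, Nat.add_right_cancel_iff] at h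
    exact Prod.ext h.1 h.2

/-- The ribbon with one cell added to the right of the last cell. -/
def addRight (R : Ribbon k) : Ribbon (k + 1) where
  outer := growRow R.outer
  outer_ne_bot h := YoungDiagram.notMem_bot (0, R.outer.rowLen 0)
    (h ▸ mem_growRow.2 (Or.inl ⟨rfl, rfl⟩))
  card_cells := by
    rw [ribbonCells_growRow, Finset.card_insert_of_notMem, R.card_cells]
    intro h
    exact lt_irrefl _ (R.lt_rowLen_of_mem_cells h)

lemma cells_addBelow (R : Ribbon k) : R.addBelow.cells =
    insert (0, R.outer.rowLen 0 - 1) (R.cells.image fun c : ℕ × ℕ => (c.1 + 1, c.2)) :=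
  ribbonCells_doubleRow R.outer_ne_bot

lemma cells_addRight (R : Ribbon k) :
    R.addRight.cells = insert (0, R.outer.rowLen 0) R.cells :=
  ribbonCells_growRow _

lemma descents_addBelow (R : Ribbon k) : R.addBelow.descents = R.descents ∪ {k} := by
  rw [descents_of_cells_eq_insert R R.addBelow 1 _ R.cells_addBelow, if_neg one_ne_zero]
  · intro c hc
    have := R.lt_rowLen_of_mem_cells hc
    omega
  · simp

lemma descents_addRight (R : Ribbon k) : R.addRight.descents = R.descents := by
  rw [descents_of_cells_eq_insert R R.addRight 0 (R.outer.rowLen 0) (by simp [cells_addRight]),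
    if_pos rfl]
  · exact fun c hc => (R.lt_rowLen_of_mem_cells hc).le
  · exact fun c hc => Or.inl (R.lt_rowLen_of_mem_cells hc)

/-- If the first two rows are equally long, the last cell sits below its predecessor and deleting
the first row undoes the addition. Otherwise the last cell of the first row can be deleted; here `k
≠ 0` ensures that something remains. -/
lemma exists_eq_addBelow_or_addRight (hk : k ≠ 0) (R : Ribbon (k + 1)) :
    ∃ R' : Ribbon k, R = R'.addBelow ∨ R = R'.addRight := by
  have h0 := rowLen_pos R.outer_ne_bot
  have h1 := R.outer.rowLen_anti 0 1 (Nat.zero_le 1)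
  rcases h1.eq_or_lt with h | h
  · let ν : YoungDiagram :=
      { cells := (R.outer.cells.filter fun c => (c.1 + 1, c.2) ∈ R.outer)
        isLowerSet := by
          rintro ⟨i, j⟩ ⟨i', j'⟩ h hc
          obtain ⟨hi, hj⟩ : i' ≤ i ∧ j' ≤ j := h
          simp only [Finset.coe_filter, Set.mem_ofPred_eq, YoungDiagram.mem_cells] at hc ⊢
          exact ⟨R.outer.up_left_mem hi hj hc.1, R.outer.up_left_mem (by omega) hj hc.2⟩ }
    have hν : ∀ i j, (i, j) ∈ ν ↔ (i + 1, j) ∈ R.outer := by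
      intro i j
      change (i, j) ∈ R.outer.cells.filter _ ↔ _
      simp only [Finset.mem_filter, YoungDiagram.mem_cells, and_iff_right_iff_imp]
      exact fun h => R.outer.up_left_mem (by omega) le_rfl h
    have hνR : doubleRow ν = R.outer := by
      refine YoungDiagram.ext (Finset.ext fun ⟨i, j⟩ => ?_)
      rw [YoungDiagram.mem_cells, YoungDiagram.mem_cells, mem_doubleRow, hν]
      cases i with
      | zero => rw [YoungDiagram.mem_iff_lt_rowLen, YoungDiagram.mem_iff_lt_rowLen, Nat.zero_sub,
          zero_add, h]
      | succ i => simp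
    have hbot : ν ≠ ⊥ := by
      intro hb
      refine YoungDiagram.notMem_bot (0, 0) (hb ▸ (hν 0 0).2 ?_)
      rw [YoungDiagram.mem_iff_lt_rowLen, zero_add]
      omega
    have hcard : (ribbonCells ν).card = k := by
      have hc := R.card_cells
      rw [← hνR, ribbonCells_doubleRow hbot, Finset.card_insert_of_notMem (by simp),
        Finset.card_image_of_injective] at hc
      · omega
      · intro a b h
        simp only [Prod.mk.injEq, Nat.add_right_cancel_iff] at h
        exact Prod.ext h.1 h.2
    exact ⟨⟨ν, hbot, hcard⟩, Or.inl (Ribbon.ext hνR.symm)⟩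
  · let ν : YoungDiagram :=
      { cells := R.outer.cells.erase (0, R.outer.rowLen 0 - 1)
        isLowerSet := by
          rintro ⟨i, j⟩ ⟨i', j'⟩ hle hc
          obtain ⟨hi, hj⟩ : i' ≤ i ∧ j' ≤ j := hle
          simp only [Finset.coe_erase, Set.mem_sdiff, Finset.mem_coe, YoungDiagram.mem_cells,
            Set.mem_singleton_iff, Prod.mk.injEq] at hc ⊢
          refine ⟨R.outer.up_left_mem hi hj hc.1, ?_⟩
          rintro ⟨rfl, rfl⟩
          have h2 := YoungDiagram.mem_iff_lt_rowLen.1 hc.1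
          rcases Nat.eq_zero_or_pos i with rfl | hi
          · omega
          · have := R.outer.rowLen_anti 1 i hi
            omega }
    have hν : ∀ i j, (i, j) ∈ ν ↔ (i, j) ∈ R.outer ∧ ¬(i = 0 ∧ j = R.outer.rowLen 0 - 1) := by
      intro i j
      change (i, j) ∈ R.outer.cells.erase _ ↔ _
      simp only [Finset.mem_erase, YoungDiagram.mem_cells, ne_eq, Prod.mk.injEq]
      tauto
    have hlen : ν.rowLen 0 = R.outer.rowLen 0 - 1 := by
      refine eq_of_forall_lt_iff fun j => ?_
      rw [← YoungDiagram.mem_iff_lt_rowLen, hν, YoungDiagram.mem_iff_lt_rowLen]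
      omega
    have hνR : growRow ν = R.outer := by
      refine YoungDiagram.ext (Finset.ext fun ⟨i, j⟩ => ?_)
      rw [YoungDiagram.mem_cells, YoungDiagram.mem_cells, mem_growRow, hν, hlen]
      have : i = 0 ∧ j = R.outer.rowLen 0 - 1 → (i, j) ∈ R.outer := by
        rintro ⟨rfl, rfl⟩
        rw [YoungDiagram.mem_iff_lt_rowLen]
        omega
      tauto
    have hcard : (ribbonCells ν).card = k := by
      have hc := R.card_cells
      rw [← hνR, ribbonCells_growRow, Finset.card_insert_of_notMem] at hc
      · omega
      · intro hmem
        exact lt_irrefl _ (YoungDiagram.mem_iff_lt_rowLen.1 (mem_ribbonCells.1 hmem).1)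
    have hbot : ν ≠ ⊥ := by
      intro hb
      rw [hb, ribbonCells, YoungDiagram.cells_bot, Finset.empty_sdiff, Finset.card_empty] at hcard
      exact hk hcard.symm
    exact ⟨⟨ν, hbot, hcard⟩, Or.inr (Ribbon.ext hνR.symm)⟩

lemma outer_cells_eq (R : Ribbon 1) : R.outer.cells = {(0, 0)} := by
  refine (Finset.Nonempty.subset_singleton_iff ⟨(0, 0), ?_⟩).1 ?_
  · exact YoungDiagram.mem_iff_lt_rowLen.2 (rowLen_pos R.outer_ne_bot)
  · refine R.outer_cells_subset.trans fun c hc => ?_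
    simp only [Finset.range_one, Finset.mem_product, Finset.mem_singleton] at hc ⊢
    exact Prod.ext hc.1 hc.2

/-- A ribbon is determined by its descent set. -/
lemma descents_injective (R R' : Ribbon k) (h : R.descents = R'.descents) : R = R' := by
  induction k with
  | zero => exact absurd R.pos (lt_irrefl 0)
  | succ k ih =>
    rcases Nat.eq_zero_or_pos k with rfl | hk
    · exact Ribbon.ext (YoungDiagram.ext (R.outer_cells_eq.trans R'.outer_cells_eq.symm))
    obtain ⟨Q, rfl | rfl⟩ := exists_eq_addBelow_or_addRight hk.ne' R <;>
    obtain ⟨Q', rfl | rfl⟩ := exists_eq_addBelow_or_addRight hk.ne' R'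
    · rw [descents_addBelow, descents_addBelow] at h
      rw [ih Q Q']
      have := congrArg (Finset.erase · k) h
      simpa [Finset.union_singleton, Finset.erase_insert Q.notMem_descents,
        Finset.erase_insert Q'.notMem_descents] using this
    · rw [descents_addBelow, descents_addRight] at h
      exact absurd (h ▸ by simp : k ∈ Q'.descents) Q'.notMem_descents
    · rw [descents_addBelow, descents_addRight] at h
      exact absurd (h ▸ by simp : k ∈ Q.descents) Q.notMem_descents
    · rw [descents_addRight, descents_addRight] at h
      rw [ih Q Q' h]

/-- Whether `k` is a descent tells the two kinds of addition apart, and the other descents recover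
the smaller ribbon. -/
lemma bijective_addRight_addBelow (hk : k ≠ 0) :
    Function.Bijective (Sum.elim addRight addBelow : Ribbon k ⊕ Ribbon k → Ribbon (k + 1)) := by
  constructor
  · have hne : ∀ Q Q' : Ribbon k, Q.addRight ≠ Q'.addBelow := fun Q Q' h => by
      have := congrArg descents h
      rw [descents_addBelow, descents_addRight] at this
      exact Q.notMem_descents (this ▸ by simp)
    rintro (Q | Q) (Q' | Q') h <;> simp only [Sum.elim_inl, Sum.elim_inr] at h
    · have := congrArg descents h
      rw [descents_addRight, descents_addRight] at this
      rw [descents_injective Q Q' this]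
    · exact absurd h (hne Q Q')
    · exact absurd h.symm (hne Q' Q)
    · have := congrArg (fun R => Finset.erase (descents R) k) h
      simp only [descents_addBelow, Finset.union_singleton,
        Finset.erase_insert Q.notMem_descents, Finset.erase_insert Q'.notMem_descents] at this
      rw [descents_injective Q Q' this]
  · intro R
    obtain ⟨Q, rfl | rfl⟩ := exists_eq_addBelow_or_addRight hk R
    · exact ⟨Sum.inr Q, rfl⟩
    · exact ⟨Sum.inl Q, rfl⟩

lemma comaj_addRight (R : Ribbon k) : R.addRight.comaj = R.comaj + k := by
  have h1 := R.maj_add_comaj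
  rw [comaj, maj, descents_addRight, ← maj, Nat.choose_succ_succ' k 1, one_add_one_eq_two,
    Nat.choose_one_right]
  omega

lemma comaj_addBelow (R : Ribbon k) : R.addBelow.comaj = R.comaj := by
  have h1 := R.maj_add_comaj
  rw [comaj, maj, descents_addBelow, Finset.union_singleton,
    Finset.sum_insert R.notMem_descents, ← maj, Nat.choose_succ_succ' k 1, one_add_one_eq_two,
    Nat.choose_one_right]
  omega

/-! ### The ribbon operators -/

lemma op_addRight (R : Ribbon k) : R.addRight.op K = R.op K * bernsteinCol K 1 := by
  rw [op, op, addRight, rc_growRow, rowLen_zero_growRow, List.range_succ, List.map_append,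
    List.prod_append, ← mul_assoc]
  simp only [List.map_cons, List.map_nil, List.prod_cons, List.prod_nil, mul_one,
    colLen_rowLen_zero_growRow, Nat.cast_one]
  congr 3
  refine List.map_congr_left fun j hj => ?_
  rw [colLen_growRow _ (List.mem_range.1 hj)]

end Ribbon

lemma schur_eq_jacobiTrudi (μ : YoungDiagram) (l : ℕ) (h : μ.colLen 0 = l) :
    schur K μ = jacobiTrudi fun i : Fin l => (μ.rowLen i : ℤ) := by
  subst h
  rfl

lemma bernstein_schur_rc [CharZero K] {μ : YoungDiagram} (h : μ ≠ ⊥) :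
    bernstein K (μ.rowLen 0 - 1) (schur K (rc μ)) = schur K (rc (doubleRow μ)) := by
  have h0 := rowLen_pos h
  rw [schur_eq_jacobiTrudi (rc μ) _ rfl, bernstein_jacobiTrudi]
  -- For a single column the added row is empty: the determinant has size one and entry `h_0 = 1`,
  -- while the Schur function of the empty partition is a determinant of size zero.
  by_cases h1 : μ.rowLen 0 = 1
  · have hcol : ∀ ν : YoungDiagram, ν.rowLen 0 ≤ 1 → (rc ν).colLen 0 = 0 := by
      intro ν hν
      by_contra hc
      have := mem_rc.1 (YoungDiagram.mem_iff_lt_colLen.2 (Nat.pos_of_ne_zero hc))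
      have := YoungDiagram.mem_iff_lt_rowLen.1 (ν.up_left_mem (Nat.zero_le _) le_rfl this)
      omega
    rw [schur_eq_jacobiTrudi (rc (doubleRow μ)) 0
      (hcol _ (by rw [rowLen_doubleRow]; exact h1.le))]
    have hc := hcol μ h1.le
    rw [jacobiTrudi, jacobiTrudi, Matrix.det_fin_zero, Matrix.det_succ_row_zero]
    generalize (rc μ).colLen 0 = l at hc
    subst hc
    simp [h1, hInt, isGen_hNat.zero]
  · have hcol : (rc (doubleRow μ)).colLen 0 = (rc μ).colLen 0 + 1 := by
      refine eq_of_forall_lt_iff fun i => ?_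
      rw [← YoungDiagram.mem_iff_lt_colLen, mem_rc, mem_doubleRow]
      cases i with
      | zero =>
        simp only [Nat.add_sub_cancel, YoungDiagram.mem_iff_lt_rowLen]
        omega
      | succ i => rw [Nat.add_sub_cancel, ← mem_rc, YoungDiagram.mem_iff_lt_colLen]; omega
    rw [schur_eq_jacobiTrudi (rc (doubleRow μ)) _ hcol]
    congr 1
    funext i
    refine Fin.cases ?_ (fun i => ?_) i
    · rw [Fin.cons_zero, rowLen_rc, rowLen_doubleRow, Fin.val_zero, zero_add, Nat.sub_self]
      omega
    · rw [Fin.cons_succ, rowLen_rc, rowLen_rc, rowLen_doubleRow, Fin.val_succ, Nat.add_sub_cancel]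

lemma Ribbon.op_addBelow [CharZero K] {k : ℕ} (R : Ribbon k) :
    R.addBelow.op K = hat (hat (R.op K) * bernstein K 1) := by
  -- With `n = λ₁` and `m = λ₁ - 1` the operator `S_{n-m}` is `S_1`.
  have h := hat_hat_skew_mul_prod_mul_bernstein (schur K (rc R.outer))
    (fun j => (R.outer.colLen j : ℤ)) (R.outer.rowLen 0) (R.outer.rowLen 0 - 1)
  rw [sub_sub_cancel] at h
  rw [op, op, h, bernstein_schur_rc R.outer_ne_bot, addBelow, rowLen_doubleRow]
  congr 2
  refine List.map_congr_left fun j hj => ?_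
  rw [colLen_doubleRow _ (List.mem_range.1 hj)]
  push_cast
  rfl

/-! ### The recursion for `H_{1^k}^q` -/

lemma hallLittlewoodCol_one [CharZero K] (q : K) :
    hallLittlewoodCol q 1 = bernsteinCol K 1 := by
  have hmem : ∀ (R : Ribbon 1) (i j : ℕ), (i, j) ∈ R.outer ↔ i = 0 ∧ j = 0 := by
    intro R i j
    rw [← YoungDiagram.mem_cells, R.outer_cells_eq]
    simp
  have hop : ∀ R : Ribbon 1, q ^ R.comaj • R.op K = bernsteinCol K 1 := by
    intro R
    have hcomaj : R.comaj = 0 := by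
      have := R.maj_add_comaj
      simp at this
      exact this.2
    have hrow : R.outer.rowLen 0 = 1 := by
      refine eq_of_forall_lt_iff fun j => ?_
      rw [← YoungDiagram.mem_iff_lt_rowLen, hmem]
      omega
    have hcol : R.outer.colLen 0 = 1 := by
      refine eq_of_forall_lt_iff fun j => ?_
      rw [← YoungDiagram.mem_iff_lt_colLen, hmem]
      omega
    have hrc : (rc R.outer).colLen 0 = 0 := by
      refine eq_of_forall_lt_iff fun j => ?_
      rw [← YoungDiagram.mem_iff_lt_colLen, mem_rc, hmem]
      omega
    rw [hcomaj, Ribbon.op, schur_eq_jacobiTrudi _ 0 hrc, hrow, jacobiTrudi, Matrix.det_fin_zero,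
      skew_one]
    simp [hcol]
  let R₀ : Ribbon 1 :=
    { outer := growRow ⊥
      outer_ne_bot := fun h => YoungDiagram.notMem_bot (0, (⊥ : YoungDiagram).rowLen 0)
        (h.subst (motive := fun ν => (0, (⊥ : YoungDiagram).rowLen 0) ∈ ν)
          (mem_growRow.2 (Or.inl ⟨rfl, rfl⟩)))
      card_cells := by rw [ribbonCells_growRow, ribbonCells]; simp }
  have hsub : ∀ R : Ribbon 1, R = R₀ := fun R =>
    Ribbon.ext (YoungDiagram.ext (R.outer_cells_eq.trans R₀.outer_cells_eq.symm))
  rw [hallLittlewoodCol, Fintype.sum_eq_single R₀ fun R hR => absurd (hsub R) hR, hop]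

lemma hallLittlewoodCol_succ [CharZero K] (q : K) {k : ℕ} (hk : k ≠ 0) :
    hallLittlewoodCol q (k + 1) = q ^ k • (hallLittlewoodCol q k * bernsteinCol K 1) +
      hat (hat (hallLittlewoodCol q k) * bernstein K 1) := by
  have hH : hallLittlewoodCol q k = ∑ R : Ribbon k, q ^ R.comaj • R.op K := by
    obtain ⟨k, rfl⟩ := Nat.exists_eq_succ_of_ne_zero hk
    rw [hallLittlewoodCol]
  rw [hH, hallLittlewoodCol,
    ← (Ribbon.bijective_addRight_addBelow hk).sum_comp fun R => q ^ R.comaj • R.op K,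
    Fintype.sum_sum_type, hat_sum, Finset.sum_mul, Finset.sum_mul, hat_sum, Finset.smul_sum]
  congr 1
  · refine Finset.sum_congr rfl fun R _ => ?_
    rw [Sum.elim_inl, R.comaj_addRight, R.op_addRight, smul_mul_assoc, smul_smul, pow_add, mul_comm]
  · refine Finset.sum_congr rfl fun R _ => ?_
    rw [Sum.elim_inr, R.comaj_addBelow, R.op_addBelow, hat_smul, smul_mul_assoc, hat_smul]

end RibbonOps
end

theorem theorem4 {K : Type*} [Field K] [CharZero K] :
    -- adding a cell below all others
    (∀ (k : ℕ) (R : RibbonOps.Ribbon k) (Rb : RibbonOps.Ribbon (k + 1)),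
      Rb.descents = R.descents ∪ {k} →
        Rb.cells = insert (0, R.outer.rowLen 0 - 1)
          (R.cells.image fun c : ℕ × ℕ => (c.1 + 1, c.2)) ∧
        RibbonOps.hat (RibbonOps.hat (R.op K) * RibbonOps.bernstein K 1) = Rb.op K) ∧
    -- adding a cell to the right of all others
    (∀ (k : ℕ) (R : RibbonOps.Ribbon k) (Rr : RibbonOps.Ribbon (k + 1)),
      Rr.descents = R.descents →
        Rr.cells = insert (0, R.outer.rowLen 0) R.cells ∧
        R.op K * RibbonOps.bernsteinCol K 1 = Rr.op K) ∧
    -- the recursion for the operators `H_{1^k}^q`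
    (∀ q : K,
      RibbonOps.hallLittlewoodCol q 1 = RibbonOps.bernsteinCol K 1 ∧
      ∀ k : ℕ, 2 ≤ k →
        RibbonOps.hallLittlewoodCol q k =
          q ^ (k - 1) • (RibbonOps.hallLittlewoodCol q (k - 1) * RibbonOps.bernsteinCol K 1) +
          RibbonOps.hat (RibbonOps.hat (RibbonOps.hallLittlewoodCol q (k - 1)) *
            RibbonOps.bernstein K 1)) := by
  refine ⟨fun k R Rb h => ?_, fun k R Rr h => ?_, fun q => ⟨?_, fun k hk => ?_⟩⟩
  · rw [← R.descents_addBelow] at h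
    rw [Rb.descents_injective _ h]
    exact ⟨R.cells_addBelow, R.op_addBelow.symm⟩
  · rw [← R.descents_addRight] at h
    rw [Rr.descents_injective _ h]
    exact ⟨R.cells_addRight, R.op_addRight.symm⟩
  · exact RibbonOps.hallLittlewoodCol_one q
  · obtain ⟨k, rfl⟩ : ∃ n, k = n + 1 := Nat.exists_eq_succ_of_ne_zero (by omega)
    exact RibbonOps.hallLittlewoodCol_succ q (by omega)
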